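/- Let $\eta:\mathbb R\to\mathbb R$ be smooth with $0\le\eta\le1$, $\eta(x)=1$ for $|x|\le 1/4$ and $\eta(x)=0$ for $|x|\ge 1/2$; let $D>32$ and $\eta_t(\xi)=\eta(2\pi D^{t+2}\xi)$ for $t\in\mathbb N_0$. For $r\ge1$ and a complex sequence $(a_N:N\in\mathbb N)$ put $$\mathcal V_r(a_N:N\in\mathbb N)=\sup_{N}|a_N|+\sup_{J,\ N_0<\dots<N_J}\Big(\sum_{j=1}^J|a_{N_j}-a_{N_{j-1}}|^r\Big)^{1/r}.$$ Write $\mathcal Ff(\xi)=\int_{\mathbb R}f(x)e^{2\pi i\xi x}\,dx$ for the Fourier transform on $\mathbb R$ (extended to $L^2(\mathbb R)$), $\hat f(\xi)=\sum_{n\in\mathbb Z}f(n)e^{2\pi i\xi n}$ for $f\in\ell^1(\mathbb Z)$, and, for a function $g$ on the circle $\mathbb T=\mathbb R/\mathbb Z$, $\mathcal F^{-1}g(n)=\int_{\mathbb T}g(\xi)e^{-2\pi i\xi n}\,d\xi$, $n\in\mathbb Z$. Let $\mathscr R_t$ be the set of points of $\mathbb T$ of the form $a/q$ with $(a,q)=1$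 and $2^t\le q<2^{t+1}$ (so $\mathscr R_0=\{0\}$). For a sequence $(\Phi_N:N\in\mathbb N)$ of complex functions on $\mathbb R$ set $$\nu_N^t(\xi)=\sum_{a/q\in\mathscr R_t}\frac{\mu(q)}{\varphi(q)}\,\Phi_N(\xi-a/q)\,\eta_t(\xi-a/q),\qquad \xi\in\mathbb T,$$ where $\mu$ is the Möbius function, $\varphi$ is Euler's totient function, and $\Phi_N\eta_t$, which is supported in $(-1/2,1/2)$, is viewed as a function on $\mathbb T$. **Theorem.** For every $s\in(1,\infty)$ there are constants $C>0$ and $\delta>0$, depending only on $s$, $D$ and $\eta$, such that the following holds. Let $r\ge1$, $B>0$, and let $(\Phi_N:N\in\mathbb N)$ be a sequence of functions on $\mathbb R$ such that for every $f\in L^s(\mathbb R)\cap L^2(\mathbb R)$ the functions $\Phi_N\mathcal Ff$ belong to $L^2(\mathbb R)$ and $$\big\|\mathcal V_r\big(\mathcal F^{-1}(\Phi_N\mathcal Ff):N\in\mathbb N\big)\big\|_{L^s(\mathbb R)}\le B\|f\|_{L^s(\mathbb R)}.$$ Then for every $t\in\mathbb N_0$ and every $f\in\ell^1(\mathbb Z)$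 the functions $\nu_N^t\hat f$ are integrable on $\mathbb T$ and $$\big\|\mathcal V_r\big(\mathcal F^{-1}(\nu_N^t\hat f):N\in\mathbb N\big)\big\|_{\ell^s(\mathbb Z)}\le C\,B\,2^{-t\delta}\,\|f\|_{\ell^s(\mathbb Z)}.$$ -/

import Mathlib

open MeasureTheory
open scoped FourierTransform ENNReal ContDiff

noncomputable section

/-- The `r`-variation seminorm `V_r(a_n : n ∈ ℕ)`, with values in `[0, ∞]`: the supremum of
`(∑_{j=1}^J |a_{n_j} - a_{n_{j-1}}|^r)^{1/r}` over all `n_0 < n_1 < ⋯ < n_J`. (Every finite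
increasing sequence of naturals is an initial segment of an infinite one.) -/
def variationSeminorm (r : ℝ) (a : ℕ → ℂ) : ℝ≥0∞ :=
  ⨆ (J : ℕ) (n : ℕ → ℕ) (_ : StrictMono n),
    (∑ j ∈ Finset.range J, ‖a (n (j + 1)) - a (n j)‖ₑ ^ r) ^ (1 / r)

/-- The `r`-variation norm `𝒱_r(a_n : n ∈ ℕ) = sup_n |a_n| + V_r(a_n : n ∈ ℕ)`. -/
def variationNorm (r : ℝ) (a : ℕ → ℂ) : ℝ≥0∞ :=
  (⨆ n, ‖a n‖ₑ) + variationSeminorm r a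

/-- For every `f ∈ L^s(ℝ) ∩ L²(ℝ)` the functions `F⁻¹(Φ_N F f)` are defined in `L²(ℝ)` and
`‖𝒱_r(F⁻¹(Φ_N F f) : N)‖_{L^s} ≤ B ‖f‖_{L^s}`. Here `F f(ξ) = ∫ f(x) e^{2πiξx} dx`, extended to
`L²(ℝ)` by Plancherel; with this sign `F` is Mathlib's `𝓕⁻` and `F⁻¹` is Mathlib's `𝓕`. -/
def HasVariationBound (Φ : ℕ → ℝ → ℂ) (r s B : ℝ) : Prop :=
  ∀ f : Lp ℂ 2 (volume : Measure ℝ), MemLp f (ENNReal.ofReal s) volume →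
    ∃ h : ∀ N, MemLp (fun ξ : ℝ => Φ N ξ * (𝓕⁻ f : Lp ℂ 2 (volume : Measure ℝ)) ξ) 2 volume,
      eLpNorm (fun x : ℝ => variationNorm r
          (fun N => (𝓕 ((h N).toLp) : Lp ℂ 2 (volume : Measure ℝ)) x))
        (ENNReal.ofReal s) volume
      ≤ ENNReal.ofReal B * eLpNorm f (ENNReal.ofReal s) volume

/-- `η_t(ξ) = η(2π D^{t+2} ξ)`. -/
def cutoff (η : ℝ → ℝ) (D : ℝ) (t : ℕ) (ξ : ℝ) : ℝ :=
  η (2 * Real.pi * D ^ (t + 2) * ξ)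

/-- The multiplier `ν_N^t(ξ) = ∑_{a/q ∈ R_t} μ(q)/φ(q) Φ_N(ξ - a/q) η_t(ξ - a/q)` on the circle
`𝕋 = ℝ/ℤ`. The set `R_t` of points `a/q ∈ 𝕋` in lowest terms with `2^t ≤ q < 2^{t+1}` is
parametrised bijectively by such `q` and `1 ≤ a ≤ q` coprime to `q` (for `t = 0` this is the one
point `1/1 = 0` of `𝕋`). The function `Φ_N η_t`, which in the situation of interest is supported
in `(-1/2, 1/2)`, is regarded as a function on `𝕋` through representatives in `[-1/2, 1/2)`. -/
def arcMultiplier (Φ : ℕ → ℝ → ℂ) (η : ℝ → ℝ) (D : ℝ) (t N : ℕ) (ξ : UnitAddCircle) : ℂ :=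
  ∑ q ∈ Finset.Ico (2 ^ t) (2 ^ (t + 1)), ∑ a ∈ (Finset.Icc 1 q).filter (fun a => a.Coprime q),
    (ArithmeticFunction.moebius q : ℂ) / (Nat.totient q : ℂ) *
      AddCircle.liftIco (1 : ℝ) (-1 / 2) (fun x : ℝ => Φ N x * (cutoff η D t x : ℂ))
        (ξ - (((a : ℝ) / (q : ℝ) : ℝ) : UnitAddCircle))

/-- `f̂(ξ) = ∑_{n ∈ ℤ} f(n) e^{2πiξn}` on the circle. -/
def seqFourier (f : ℤ → ℂ) (ξ : UnitAddCircle) : ℂ :=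
  ∑' n : ℤ, f n * fourier n ξ

end

open scoped SchwartzMap

/-! Taking Fourier coefficients and moving each arc to the origin turns the sum over `a` into a
Ramanujan twist: the contribution of `q` at the integer `x` is μ(q)/φ(q) times the transform at `x`
of Φ_N η_t against the Fourier series of n ↦ c_q(n - x) f(n) (`fourierCoeff_arcMultiplier_mul`).
This sequence depends on `x` only modulo `q`, so on each class x ≡ l one samples a fixed
band-limited function on ℝ. The cutoff lives at scale S ≥ q, so the sum over the class is at most a
constant times 1/q times an integral over ℝ (`tsum_variationNorm_rpow_le`). There the hypothesis
removes Φ_N and costs B, leaving the functions `arcPiece χ q l f`.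

These are the values of one linear operator acting on f, with target the triples (q, l, y), the pair
(q, l) having weight 1/q. Its ℓ² norm is at most 1, by orthogonality of characters modulo q and
disjointness of the arcs (`sum_sum_lintegral_enorm_sq_arcPiece_le`). Write d for a bound on the
divisor counts. Since c_q has absolute mean at most d(q) over a period (`sum_norm_ramanujanSum_le`),
the ℓ^∞ norm is O(d) and the ℓ¹ norm is O(d 2^t), the last factor counting the denominators. Real
interpolation bounds the s-th power of the ℓ^s norm by O(d^s 2^{t max(2-s,0)}).

The sum over q is recovered by Hölder: |μ(q)/φ(q)| ≤ d/2^t and there are at most 2^t denominators,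
which gives the factor d^s 2^{-t}. The total is d^{2s} 2^{-t min(1,s-1)}. Only squarefree q matter,
and for them d = O(2^{tε}) for every ε > 0, so a small ε leaves geometric decay. -/

/-! ### The variation norm: Minkowski, homogeneity, subadditivity, measurability -/

/-- Minkowski's integral inequality, read off from the Bochner integral in the normed space ℓ^r on J
points; r ≥ 1 is what makes it a normed space. -/
theorem enorm_integral_le_variationAux {Y : Type*} [MeasurableSpace Y] {μ : Measure Y} {r : ℝ}
    (hr : 1 ≤ r) (J : ℕ) (G : ℕ → Y → ℂ) (hG : ∀ j, Integrable (G j) μ) :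
    (∑ j ∈ Finset.range J, ‖∫ y, G j y ∂μ‖ₑ ^ r) ^ (1 / r) ≤
      ∫⁻ y, (∑ j ∈ Finset.range J, ‖G j y‖ₑ ^ r) ^ (1 / r) ∂μ := by
  have hr0 : 0 < r := by linarith
  have : Fact (1 ≤ ENNReal.ofReal r) := ⟨by simpa using ENNReal.ofReal_le_ofReal hr⟩
  have key : ∀ v : Fin J → ℂ, ‖WithLp.toLp (ENNReal.ofReal r) v‖ₑ =
      (∑ j, ‖v j‖ₑ ^ r) ^ (1 / r) := by
    intro v
    have h1 : (ENNReal.ofReal r).toReal = r := ENNReal.toReal_ofReal hr0.le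
    have h2 := PiLp.nnnorm_eq_sum (p := ENNReal.ofReal r) (β := fun _ : Fin J => ℂ)
      ENNReal.ofReal_ne_top (WithLp.toLp (ENNReal.ofReal r) v)
    rw [enorm_eq_nnnorm, h2, h1, ENNReal.coe_rpow_of_nonneg _ (by positivity)]
    push_cast
    simp [ENNReal.coe_rpow_of_nonneg _ hr0.le, enorm_eq_nnnorm]
  have hint : ∀ j : Fin J, Integrable
      (fun y => WithLp.toLp (ENNReal.ofReal r) (fun j : Fin J => G j y) j) μ := fun j => hG j
  have h3 : (∫ y, WithLp.toLp (ENNReal.ofReal r) (fun j : Fin J => G j y) ∂μ) =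
      WithLp.toLp (ENNReal.ofReal r) (fun j : Fin J => ∫ y, G j y ∂μ) := by
    ext j
    rw [eval_integral_piLp hint]
  have h4 := enorm_integral_le_lintegral_enorm (μ := μ)
    (fun y => WithLp.toLp (ENNReal.ofReal r) (fun j : Fin J => G j y))
  rw [h3] at h4
  simpa only [key, Finset.sum_range] using h4

theorem le_variationSeminorm {r : ℝ} (a : ℕ → ℂ) (J : ℕ) {n : ℕ → ℕ} (hn : StrictMono n) :
    (∑ j ∈ Finset.range J, ‖a (n (j + 1)) - a (n j)‖ₑ ^ r) ^ (1 / r) ≤ variationSeminorm r a :=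
  le_iSup_of_le J (le_iSup_of_le n (le_iSup_of_le hn le_rfl))

/-- Lets the variation norm pass inside a convolution. The lower integral is superadditive without
measurability, so none is asked of the right-hand integrand. -/
theorem variationNorm_integral_le {Y : Type*} [MeasurableSpace Y] {μ : Measure Y} {r : ℝ}
    (hr : 1 ≤ r) (F : ℕ → Y → ℂ) (hF : ∀ N, Integrable (F N) μ) :
    variationNorm r (fun N => ∫ y, F N y ∂μ) ≤ ∫⁻ y, variationNorm r (fun N => F N y) ∂μ := by
  refine le_trans (add_le_add ?_ ?_) (le_lintegral_add _ _)
  · refine iSup_le fun n => (enorm_integral_le_lintegral_enorm _).trans (lintegral_mono fun y => ?_)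
    exact le_iSup (fun n => ‖F n y‖ₑ) n
  · refine iSup_le fun J => iSup_le fun n => iSup_le fun hn => ?_
    have h := enorm_integral_le_variationAux (μ := μ) hr J (fun j y => F (n (j + 1)) y - F (n j) y)
      (fun j => (hF _).sub (hF _))
    simp only [integral_sub (hF _) (hF _)] at h
    exact h.trans (lintegral_mono fun y => le_variationSeminorm (fun N => F N y) J hn)

theorem variationNorm_const_mul_le {r : ℝ} (hr : 1 ≤ r) (c : ℂ) (a : ℕ → ℂ) :
    variationNorm r (fun N => c * a N) ≤ ‖c‖ₑ * variationNorm r a := by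
  have hr0 : 0 < r := by linarith
  rw [variationNorm, variationNorm, mul_add]
  refine add_le_add ?_ ?_
  · refine iSup_le fun n => ?_
    rw [enorm_mul]
    gcongr
    exact le_iSup (fun n => ‖a n‖ₑ) n
  · refine iSup_le fun J => iSup_le fun n => iSup_le fun hn => ?_
    refine le_trans (le_of_eq ?_) (mul_le_mul_right (le_variationSeminorm (r := r) a J hn) _)
    simp only [← mul_sub, enorm_mul, ENNReal.mul_rpow_of_nonneg _ _ hr0.le, ← Finset.mul_sum]
    rw [ENNReal.mul_rpow_of_nonneg _ _ (by positivity), ← ENNReal.rpow_mul,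
      mul_one_div_cancel hr0.ne', ENNReal.rpow_one]

theorem variationNorm_add_le {r : ℝ} (hr : 1 ≤ r) (a b : ℕ → ℂ) :
    variationNorm r (fun N => a N + b N) ≤ variationNorm r a + variationNorm r b := by
  have hr0 : 0 < r := by linarith
  rw [variationNorm, variationNorm, variationNorm, add_add_add_comm]
  refine add_le_add ?_ ?_
  · refine iSup_le fun n => (enorm_add_le _ _).trans (add_le_add ?_ ?_)
    · exact le_iSup (fun n => ‖a n‖ₑ) n
    · exact le_iSup (fun n => ‖b n‖ₑ) n
  · refine iSup_le fun J => iSup_le fun n => iSup_le fun hn => ?_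
    refine le_trans ?_ (add_le_add (le_variationSeminorm (r := r) a J hn)
      (le_variationSeminorm (r := r) b J hn))
    refine le_trans ?_ (ENNReal.Lp_add_le _ _ _ hr)
    gcongr with j hj
    rw [add_sub_add_comm]
    exact enorm_add_le _ _

theorem variationNorm_sum_le {ι : Type*} {r : ℝ} (hr : 1 ≤ r) (s : Finset ι) (c : ι → ℂ)
    (a : ι → ℕ → ℂ) :
    variationNorm r (fun N => ∑ i ∈ s, c i * a i N) ≤ ∑ i ∈ s, ‖c i‖ₑ * variationNorm r (a i) := by
  classical
  have hr0 : 0 < r := by linarith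
  induction s using Finset.induction_on with
  | empty => simp [variationNorm, variationSeminorm, hr0]
  | insert i s hi ih =>
    simp only [Finset.sum_insert hi]
    exact (variationNorm_add_le hr _ _).trans
      (add_le_add (variationNorm_const_mul_le hr _ _) ih)

/-- The supremum runs over uncountably many sequences `n`; continuity of the `H N` makes it lower
semicontinuous, hence measurable. -/
theorem measurable_variationNorm {r : ℝ} (hr : 1 ≤ r) {H : ℕ → ℝ → ℂ} (hH : ∀ N, Continuous (H N)) :
    Measurable (fun y => variationNorm r (fun N => H N y)) := by
  have hr0 : 0 < r := by linarith
  refine Measurable.add ?_ ?_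
  · exact Measurable.iSup fun n => (hH n).measurable.enorm
  · refine LowerSemicontinuous.measurable ?_
    refine lowerSemicontinuous_iSup fun J => lowerSemicontinuous_iSup fun n =>
      lowerSemicontinuous_iSup fun hn => Continuous.lowerSemicontinuous ?_
    refine ENNReal.continuous_rpow_const.comp ?_
    refine continuous_finsetSum _ fun j _ => ENNReal.continuous_rpow_const.comp ?_
    exact ((hH _).sub (hH _)).enorm

/-! ### Fourier transforms on the line and kernels of dilated cutoffs -/

/-- Both transforms can be moved onto a smooth compactly supported test function, so they agree as
distributions. -/
theorem fourier_toLp_ae_eq {g : ℝ → ℂ} (hg : Integrable g) (hg2 : MemLp g 2) :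
    (𝓕 (hg2.toLp g) : Lp ℂ 2 (volume : Measure ℝ)) =ᵐ[volume] 𝓕 g := by
  refine ae_eq_of_integral_contDiff_smul_eq (μ := volume) ?_ ?_ ?_
  · exact (Lp.memLp _).locallyIntegrable (by norm_num)
  · exact (VectorFourier.fourierIntegral_continuous Real.continuous_fourierChar
      (by exact continuous_inner) hg).locallyIntegrable
  · intro φ hφ hφc
    have hc : HasCompactSupport (fun x => (φ x : ℂ)) := hφc.comp_left (g := ((↑) : ℝ → ℂ)) (by simp)
    have hs : ContDiff ℝ ∞ (fun x => (φ x : ℂ)) := Complex.ofRealCLM.contDiff.comp hφ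
    have h1 := congrArg (fun T : 𝓢'(ℝ, ℂ) => T (hc.toSchwartzMap hs))
      (Lp.fourier_toTemperedDistribution_eq (hg2.toLp g))
    simp only [TemperedDistribution.fourier_apply, Lp.toTemperedDistribution_apply] at h1
    have h2 : ∫ x, (𝓕 (hc.toSchwartzMap hs)) x • (hg2.toLp g) x =
        ∫ x, (𝓕 (fun x => (φ x : ℂ))) x • g x := by
      refine integral_congr_ae ?_
      filter_upwards [hg2.coeFn_toLp] with x hx
      rw [hx, SchwartzMap.fourier_coe]
      rfl
    have h3 := VectorFourier.integral_fourierIntegral_smul_eq_flip (μ := volume) (ν := volume)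
      (L := innerₗ ℝ) Real.continuous_fourierChar continuous_inner
      (hs.continuous.integrable_of_hasCompactSupport hc) hg
    rw [flip_innerₗ] at h3
    calc ∫ x, φ x • (𝓕 (hg2.toLp g) : Lp ℂ 2 (volume : Measure ℝ)) x
        = ∫ x, (hc.toSchwartzMap hs) x • (𝓕 (hg2.toLp g) : Lp ℂ 2 (volume : Measure ℝ)) x := by
          refine integral_congr_ae (Filter.Eventually.of_forall fun x => ?_)
          simp
      _ = ∫ x, (φ x : ℂ) • (𝓕 g) x := (h1.symm.trans h2).trans h3
      _ = _ := by simp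

theorem lintegral_enorm_fourier_sq {g : ℝ → ℂ} (hg : Integrable g) (hg2 : MemLp g 2) :
    ∫⁻ y, ‖𝓕 g y‖ₑ ^ 2 = ∫⁻ ξ, ‖g ξ‖ₑ ^ 2 := by
  have h := Lp.norm_fourier_eq (hg2.toLp g)
  rw [Lp.norm_def, Lp.norm_def, eLpNorm_congr_ae (fourier_toLp_ae_eq hg hg2),
    eLpNorm_congr_ae hg2.coeFn_toLp] at h
  have hfin : eLpNorm (𝓕 g) 2 volume ≠ ⊤ := by
    rw [← eLpNorm_congr_ae (fourier_toLp_ae_eq hg hg2)]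
    exact (Lp.memLp _).eLpNorm_ne_top
  have h' := (ENNReal.toReal_eq_toReal_iff' hfin hg2.eLpNorm_ne_top).1 h
  have h2 : ∀ f : ℝ → ℂ, ∫⁻ y, ‖f y‖ₑ ^ 2 = eLpNorm f 2 volume ^ 2 := by
    intro f
    have := eLpNorm_nnreal_pow_eq_lintegral (μ := (volume : Measure ℝ)) (f := f) (p := 2) (by simp)
    simpa using this.symm
  rw [h2, h2, h']

theorem fourier_comp_mul_left (g : ℝ → ℂ) {S : ℝ} (hS : 0 < S) (y : ℝ) :
    𝓕 (fun ξ => g (S * ξ)) y = (S⁻¹ : ℝ) • 𝓕 g (y / S) := by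
  rw [Real.fourier_real_eq, Real.fourier_real_eq]
  have h := Measure.integral_comp_mul_left (fun u : ℝ => 𝐞 (-(u * (y / S))) • g u) S
  rw [abs_of_pos (inv_pos.2 hS)] at h
  rw [← h]
  refine integral_congr_ae (Filter.Eventually.of_forall fun v => ?_)
  have : S * v * (y / S) = v * y := by field_simp
  simp only [this]

/-- `K` is bounded by the `L¹`-normalised dilation by `S` of `C / (1 + y²)`. -/
def IsAdaptedKernel (C S : ℝ) (K : ℝ → ℂ) : Prop :=
  ∀ y, ‖K y‖ ≤ C * (S⁻¹ * (1 + (y / S) ^ 2)⁻¹)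

/-- Scaling reduces every S to the decay of the single Schwartz function 𝓕 g. That `C` is the same
for all S is what makes the final constant independent of t. -/
theorem exists_isAdaptedKernel_fourier {g : ℝ → ℂ} (hg : ContDiff ℝ ∞ g) (hc : HasCompactSupport g) :
    ∃ C : ℝ, 0 < C ∧ ∀ S : ℝ, 0 < S → IsAdaptedKernel C S (𝓕 (fun ξ => g (S * ξ))) := by
  obtain ⟨C0, hC0, h0⟩ := (𝓕 (hc.toSchwartzMap hg)).decay 0 0
  obtain ⟨C2, hC2, h2⟩ := (𝓕 (hc.toSchwartzMap hg)).decay 2 0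
  refine ⟨C0 + C2, by positivity, fun S hS y => ?_⟩
  rw [fourier_comp_mul_left g hS, norm_smul, Real.norm_of_nonneg (by positivity), mul_left_comm]
  refine mul_le_mul_of_nonneg_left ?_ (by positivity)
  have e : 𝓕 g = 𝓕 (hc.toSchwartzMap hg) := by rw [SchwartzMap.fourier_coe]; rfl
  have a0 := h0 (y / S)
  have a2 := h2 (y / S)
  simp only [pow_zero, one_mul, norm_iteratedFDeriv_zero, Real.norm_eq_abs, sq_abs] at a0 a2
  rw [e, ← div_eq_mul_inv, le_div_iff₀ (by positivity)]
  linarith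

theorem IsAdaptedKernel.lintegral_le {C S : ℝ} {K : ℝ → ℂ} (hC : 0 ≤ C) (hS : 0 < S)
    (hK : IsAdaptedKernel C S K) : ∫⁻ y, ‖K y‖ₑ ≤ ENNReal.ofReal (C * Real.pi) := by
  have hi : Integrable (fun y : ℝ => C * (S⁻¹ * (1 + (y / S) ^ 2)⁻¹)) :=
    ((integrable_inv_one_add_sq.comp_div hS.ne').const_mul _).const_mul _
  calc ∫⁻ y, ‖K y‖ₑ ≤ ∫⁻ y, ENNReal.ofReal (C * (S⁻¹ * (1 + (y / S) ^ 2)⁻¹)) := by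
        refine lintegral_mono fun y => ?_
        rw [← ofReal_norm]
        exact ENNReal.ofReal_le_ofReal (hK y)
    _ = ENNReal.ofReal (∫ y, C * (S⁻¹ * (1 + (y / S) ^ 2)⁻¹)) := by
        rw [ofReal_integral_eq_lintegral_ofReal hi (Filter.Eventually.of_forall fun y => by positivity)]
    _ = ENNReal.ofReal (C * Real.pi) := by
        rw [integral_const_mul, integral_const_mul,
          Measure.integral_comp_div (fun u : ℝ => (1 + u ^ 2)⁻¹) S, integral_univ_inv_one_add_sq,
          abs_of_pos hS, smul_eq_mul, inv_mul_cancel_left₀ hS.ne']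

theorem inv_one_add_sq_le {u v : ℝ} (h : |u - v| ≤ 1) : (1 + u ^ 2)⁻¹ ≤ 3 * (1 + v ^ 2)⁻¹ := by
  rw [← div_eq_mul_inv, le_div_iff₀ (by positivity), inv_mul_le_iff₀ (by positivity)]
  have := abs_le.1 h
  nlinarith [sq_nonneg (u + (u - v)), sq_nonneg (u - (v - u))]

/-- A Riemann sum with mesh q ≤ S: over one mesh interval the majorant varies by a factor at most 3,
and the intervals tile ℝ, so the sum is at most 3/q times the integral Cπ. -/
theorem IsAdaptedKernel.tsum_le {C S : ℝ} {K : ℝ → ℂ} (hC : 0 ≤ C) {q : ℕ} (hq : 0 < q)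
    (hS : q ≤ S) (hK : IsAdaptedKernel C S K) (z : ℝ) :
    ∑' m : ℤ, ‖K (z + q * m)‖ₑ ≤ ENNReal.ofReal (3 * C * Real.pi / q) := by
  have hq' : (0 : ℝ) < q := by exact_mod_cast hq
  have hS0 : 0 < S := hq'.trans_le hS
  set G : ℝ → ℝ≥0∞ := fun y => ENNReal.ofReal (3 * C / q * (S⁻¹ * (1 + (y / S) ^ 2)⁻¹)) with hG
  have hi : Integrable (fun y : ℝ => 3 * C / q * (S⁻¹ * (1 + (y / S) ^ 2)⁻¹)) :=
    ((integrable_inv_one_add_sq.comp_div hS0.ne').const_mul _).const_mul _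
  have h1 : ∀ m : ℤ, ‖K (z + q * m)‖ₑ ≤
      ∫⁻ y in Set.Ioc (z + m • (q : ℝ)) (z + (m + 1) • (q : ℝ)), G y := by
    intro m
    have hvol : volume (Set.Ioc (z + m • (q : ℝ)) (z + (m + 1) • (q : ℝ))) = ENNReal.ofReal q := by
      rw [Real.volume_Ioc]; congr 1; simp only [zsmul_eq_mul]; push_cast; ring
    calc ‖K (z + q * m)‖ₑ ≤ ENNReal.ofReal (C * (S⁻¹ * (1 + ((z + q * m) / S) ^ 2)⁻¹)) := by
          rw [← ofReal_norm]
          exact ENNReal.ofReal_le_ofReal (hK _)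
      _ = ENNReal.ofReal (C / q * (S⁻¹ * (1 + ((z + q * m) / S) ^ 2)⁻¹)) *
            volume (Set.Ioc (z + m • (q : ℝ)) (z + (m + 1) • (q : ℝ))) := by
          rw [hvol, ← ENNReal.ofReal_mul (by positivity)]
          congr 1
          field_simp
      _ = ∫⁻ _ in Set.Ioc (z + m • (q : ℝ)) (z + (m + 1) • (q : ℝ)),
            ENNReal.ofReal (C / q * (S⁻¹ * (1 + ((z + q * m) / S) ^ 2)⁻¹)) := by
          rw [setLIntegral_const]
      _ ≤ _ := by
          refine setLIntegral_mono' measurableSet_Ioc fun y hy => ENNReal.ofReal_le_ofReal ?_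
          have h : |(z + q * m) / S - y / S| ≤ 1 := by
            rw [← sub_div, abs_div, abs_of_pos hS0, div_le_one hS0]
            refine le_trans ?_ hS
            simp only [zsmul_eq_mul, Set.mem_Ioc] at hy
            push_cast at hy
            rw [abs_le]; constructor <;> linarith [hy.1, hy.2]
          have := inv_one_add_sq_le h
          calc C / q * (S⁻¹ * (1 + ((z + q * m) / S) ^ 2)⁻¹)
              ≤ C / q * (S⁻¹ * (3 * (1 + (y / S) ^ 2)⁻¹)) := by gcongr
            _ = _ := by ring
  calc ∑' m : ℤ, ‖K (z + q * m)‖ₑ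
      ≤ ∑' m : ℤ, ∫⁻ y in Set.Ioc (z + m • (q : ℝ)) (z + (m + 1) • (q : ℝ)), G y :=
        ENNReal.tsum_le_tsum h1
    _ = ∫⁻ y in ⋃ m : ℤ, Set.Ioc (z + m • (q : ℝ)) (z + (m + 1) • (q : ℝ)), G y :=
        (lintegral_iUnion (fun _ => measurableSet_Ioc)
          (Set.pairwise_disjoint_Ioc_add_zsmul z (q : ℝ)) _).symm
    _ = ∫⁻ y, G y := by rw [iUnion_Ioc_add_zsmul hq', setLIntegral_univ]
    _ = ENNReal.ofReal (∫ y, 3 * C / q * (S⁻¹ * (1 + (y / S) ^ 2)⁻¹)) := by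
        rw [ofReal_integral_eq_lintegral_ofReal hi (Filter.Eventually.of_forall fun y => by positivity)]
    _ = ENNReal.ofReal (3 * C * Real.pi / q) := by
        rw [integral_const_mul, integral_const_mul,
          Measure.integral_comp_div (fun u : ℝ => (1 + u ^ 2)⁻¹) S, integral_univ_inv_one_add_sq,
          abs_of_pos hS0, smul_eq_mul, inv_mul_cancel_left₀ hS0.ne']
        congr 1; ring

/-! ### Sampling band-limited functions along progressions -/

/-- The reproducing formula 𝓕 m = 𝓕 m * 𝓕 χ. Fourier inversion is used only for the Schwartz
function χ, since 𝓕 m need not be integrable. -/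
theorem fourier_eq_integral_mul {m χ : ℝ → ℂ} (hm : Integrable m) (hχ : ContDiff ℝ ∞ χ)
    (hc : HasCompactSupport χ) (hmχ : ∀ ξ, m ξ * χ ξ = m ξ) (x : ℝ) :
    𝓕 m x = ∫ y, 𝓕 m (x - y) * 𝓕 χ y := by
  -- Reflected and modulated so that 𝓕 f y = 𝓕 m (x - y); pairing `f` with 𝓕 𝓕 χ then gives the
  -- convolution.
  set f : ℝ → ℂ := fun v => 𝐞 (v * x) • m (-v) with hf
  have hfi : Integrable f := by
    refine hm.comp_neg.bdd_mul (f := fun v => (𝐞 (v * x) : ℂ)) (c := 1) ?_ (Filter.Eventually.of_forall fun v => ?_)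
    · exact (continuous_subtype_val.comp
        (Real.continuous_fourierChar.comp (by fun_prop))).aestronglyMeasurable
    · exact (Circle.norm_coe _).le
  have e1 : ∀ y, 𝓕 f y = 𝓕 m (x - y) := by
    intro y
    rw [Real.fourier_real_eq, Real.fourier_real_eq, ← integral_neg_eq_self]
    refine integral_congr_ae (Filter.Eventually.of_forall fun v => ?_)
    simp only [hf, smul_smul, neg_neg, ← AddChar.map_add_eq_mul]
    congr 2
    ring
  have hk : 𝓕 χ = 𝓕 (hc.toSchwartzMap hχ) := by rw [SchwartzMap.fourier_coe]; rfl
  have e2 : ∀ v, 𝓕 (𝓕 χ) v = χ (-v) := by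
    intro v
    have h1 : 𝓕⁻ (𝓕 (hc.toSchwartzMap hχ)) = hc.toSchwartzMap hχ :=
      FourierTransform.fourierInv_fourier_eq _
    have h2 := congrArg (fun g : 𝓢(ℝ, ℂ) => g (-v)) h1
    simp only [SchwartzMap.fourierInv_coe, SchwartzMap.fourier_coe] at h2
    rw [Real.fourierInv_eq_fourier_neg, neg_neg] at h2
    exact h2
  have h3 := VectorFourier.integral_fourierIntegral_smul_eq_flip (μ := volume) (ν := volume)
      (L := innerₗ ℝ) Real.continuous_fourierChar continuous_inner
      hfi (g := 𝓕 χ) (by rw [hk]; exact (𝓕 (hc.toSchwartzMap hχ)).integrable)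
  rw [flip_innerₗ] at h3
  calc 𝓕 m x = ∫ v, f v * 𝓕 (𝓕 χ) v := by
        rw [Real.fourier_real_eq, ← integral_neg_eq_self]
        refine integral_congr_ae (Filter.Eventually.of_forall fun v => ?_)
        simp only [hf, e2, Circle.smul_def, smul_eq_mul, mul_assoc, hmχ, neg_mul, neg_neg]
    _ = ∫ y, 𝓕 f y * 𝓕 χ y := h3.symm
    _ = _ := by simp only [e1]

/-- Hölder for `f` against 1 in the measure with density `g`. -/
theorem lintegral_mul_rpow_le {f g : ℝ → ℝ≥0∞} (hf : Measurable f) (hg : Measurable g) {s : ℝ}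
    (hs : 1 < s) : (∫⁻ y, f y * g y) ^ s ≤ (∫⁻ y, g y) ^ (s - 1) * ∫⁻ y, f y ^ s * g y := by
  have hs0 : 0 < s := by linarith
  have hs1 : 0 < s - 1 := by linarith
  have hpq : s.HolderConjugate (s / (s - 1)) := Real.HolderConjugate.conjExponent hs
  have h := ENNReal.lintegral_mul_le_Lp_mul_Lq (volume.withDensity g) hpq
    (f := f) (g := fun _ => 1) hf.aemeasurable aemeasurable_const
  simp only [lintegral_withDensity_eq_lintegral_mul _ hg measurable_const,
    lintegral_withDensity_eq_lintegral_mul _ hg (hf.pow_const s),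
    Pi.mul_apply, mul_one, ENNReal.one_rpow] at h
  rw [lintegral_withDensity_eq_lintegral_mul _ hg hf] at h
  simp only [Pi.mul_apply] at h
  calc (∫⁻ y, f y * g y) ^ s ≤ ((∫⁻ y, g y * f y ^ s) ^ (1 / s) * (∫⁻ y, g y) ^ (1 / (s / (s - 1)))) ^ s := by
        gcongr
        simpa only [mul_comm (g _)] using h
    _ = _ := by
        rw [ENNReal.mul_rpow_of_nonneg _ _ hs0.le, ← ENNReal.rpow_mul, ← ENNReal.rpow_mul, mul_comm]
        simp only [mul_comm (g _)]
        congr 2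
        · field_simp
        · field_simp
          simp

/-- By the reproducing formula and Minkowski, the variation norm V satisfies V ≤ V * |𝓕 χ|. Hölder
moves the power s onto V, and summing the kernel over the progression produces the factor 1/q. -/
theorem tsum_variationNorm_rpow_le {r s C S : ℝ} (hr : 1 ≤ r) (hs : 1 < s) (hC : 0 ≤ C) {q : ℕ}
    (hq : 0 < q) (hS : q ≤ S) {m : ℕ → ℝ → ℂ} {χ : ℝ → ℂ} (hm : ∀ N, Integrable (m N))
    (hχ : ContDiff ℝ ∞ χ) (hc : HasCompactSupport χ) (hmχ : ∀ N ξ, m N ξ * χ ξ = m N ξ)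
    (hK : IsAdaptedKernel C S (𝓕 χ)) (l : ℝ) :
    ∑' k : ℤ, variationNorm r (fun N => 𝓕 (m N) (l + q * k)) ^ s ≤
      ENNReal.ofReal (C * Real.pi) ^ (s - 1) * (ENNReal.ofReal (3 * C * Real.pi / q) *
        ∫⁻ y, variationNorm r (fun N => 𝓕 (m N) y) ^ s) := by
  have hq' : (0 : ℝ) < q := by exact_mod_cast hq
  have hS0 : 0 < S := hq'.trans_le hS
  have hcont : ∀ N, Continuous (𝓕 (m N)) := fun N =>
    VectorFourier.fourierIntegral_continuous Real.continuous_fourierChar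
      (by exact continuous_inner) (hm N)
  have hk : 𝓕 χ = 𝓕 (hc.toSchwartzMap hχ) := by rw [SchwartzMap.fourier_coe]; rfl
  have hKi : Integrable (𝓕 χ) := by rw [hk]; exact (𝓕 (hc.toSchwartzMap hχ)).integrable
  have hKc : Continuous (𝓕 χ) := by rw [hk]; exact (𝓕 (hc.toSchwartzMap hχ)).continuous
  set V : ℝ → ℝ≥0∞ := fun y => variationNorm r (fun N => 𝓕 (m N) y) with hV
  have hVm : Measurable V := measurable_variationNorm hr hcont
  have hKm : Measurable (fun y => ‖𝓕 χ y‖ₑ) := hKc.enorm.measurable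
  have h1 : ∀ x, V x ≤ ∫⁻ y, V (x - y) * ‖𝓕 χ y‖ₑ := by
    intro x
    have hFi : ∀ N, Integrable (fun y => 𝓕 (m N) (x - y) * 𝓕 χ y) := by
      intro N
      refine hKi.bdd_mul (c := ∫ v, ‖m N v‖)
        ((hcont N).comp (by fun_prop)).aestronglyMeasurable
        (Filter.Eventually.of_forall fun y => ?_)
      exact VectorFourier.norm_fourierIntegral_le_integral_norm _ _ _ _ _
    calc V x = variationNorm r (fun N => ∫ y, 𝓕 (m N) (x - y) * 𝓕 χ y) := by
          simp only [hV]
          congr 1; ext N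
          exact fourier_eq_integral_mul (hm N) hχ hc (hmχ N) x
      _ ≤ ∫⁻ y, variationNorm r (fun N => 𝓕 (m N) (x - y) * 𝓕 χ y) :=
          variationNorm_integral_le hr _ hFi
      _ ≤ _ := by
          refine lintegral_mono fun y => ?_
          simp only [mul_comm _ (𝓕 χ y)]
          rw [mul_comm]
          exact variationNorm_const_mul_le hr _ _
  have h2 : ∀ x, V x ^ s ≤ ENNReal.ofReal (C * Real.pi) ^ (s - 1) *
      ∫⁻ y, V y ^ s * ‖𝓕 χ (x - y)‖ₑ := by
    intro x
    calc V x ^ s ≤ (∫⁻ y, V (x - y) * ‖𝓕 χ y‖ₑ) ^ s := by gcongr; exact h1 x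
      _ ≤ (∫⁻ y, ‖𝓕 χ y‖ₑ) ^ (s - 1) * ∫⁻ y, V (x - y) ^ s * ‖𝓕 χ y‖ₑ :=
          lintegral_mul_rpow_le (hVm.comp (by fun_prop)) hKm hs
      _ = (∫⁻ y, ‖𝓕 χ y‖ₑ) ^ (s - 1) * ∫⁻ y, V y ^ s * ‖𝓕 χ (x - y)‖ₑ := by
          rw [← lintegral_sub_left_eq_self (fun y => V y ^ s * ‖𝓕 χ (x - y)‖ₑ) x]
          simp only [sub_sub_cancel]
      _ ≤ _ := by
          refine mul_le_mul_left (ENNReal.rpow_le_rpow (hK.lintegral_le hC hS0) ?_) _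
          linarith
  calc ∑' k : ℤ, V (l + q * k) ^ s
      ≤ ∑' k : ℤ, ENNReal.ofReal (C * Real.pi) ^ (s - 1) *
          ∫⁻ y, V y ^ s * ‖𝓕 χ (l + q * k - y)‖ₑ := ENNReal.tsum_le_tsum fun k => h2 _
    _ = ENNReal.ofReal (C * Real.pi) ^ (s - 1) *
          ∫⁻ y, V y ^ s * ∑' k : ℤ, ‖𝓕 χ (l + q * k - y)‖ₑ := by
        rw [ENNReal.tsum_mul_left, ← lintegral_tsum]
        · simp only [ENNReal.tsum_mul_left]
        · intro k
          exact ((hVm.pow_const s).mul (hKm.comp (by fun_prop))).aemeasurable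
    _ ≤ ENNReal.ofReal (C * Real.pi) ^ (s - 1) *
          ∫⁻ y, V y ^ s * ENNReal.ofReal (3 * C * Real.pi / q) := by
        gcongr with y
        have := hK.tsum_le hC hq hS (l - y)
        simpa only [sub_add_eq_add_sub] using this
    _ = _ := by
        rw [lintegral_mul_const _ (hVm.pow_const s), mul_comm (∫⁻ y, V y ^ s)]

/-! ### Real interpolation for operators on summable sequences -/

theorem lintegral_Ioi_ite_lt {b p : ℝ} (hb : 0 ≤ b) (hp : -1 < p) :
    ∫⁻ t in Set.Ioi (0 : ℝ), (if t < b then ENNReal.ofReal (t ^ p) else 0) =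
      ENNReal.ofReal (b ^ (p + 1) / (p + 1)) := by
  have h0 : ∫⁻ t in Set.Ioi (0 : ℝ), (if t < b then ENNReal.ofReal (t ^ p) else 0) =
      ∫⁻ t in Set.Ioo 0 b, ENNReal.ofReal (t ^ p) := by
    have : (fun t : ℝ => if t < b then ENNReal.ofReal (t ^ p) else 0) =
        (Set.Iio b).indicator (fun t => ENNReal.ofReal (t ^ p)) := by
      ext t; simp [Set.indicator_apply]
    rw [this, setLIntegral_indicator measurableSet_Iio, Set.inter_comm, Set.Ioi_inter_Iio]
  rw [h0, setLIntegral_congr Ioo_ae_eq_Ioc, ← ofReal_integral_eq_lintegral_ofReal]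
  · rw [← intervalIntegral.integral_of_le hb, integral_rpow (Or.inl hp),
      Real.zero_rpow (by linarith), sub_zero]
  · exact (intervalIntegral.intervalIntegrable_rpow' hp).1
  · filter_upwards [ae_restrict_mem measurableSet_Ioc] with t ht
    exact Real.rpow_nonneg ht.1.le _

theorem lintegral_Ioi_ite_le {b p : ℝ} (hb : 0 < b) (hp : p < -1) :
    ∫⁻ t in Set.Ioi (0 : ℝ), (if b ≤ t then ENNReal.ofReal (t ^ p) else 0) =
      ENNReal.ofReal (-b ^ (p + 1) / (p + 1)) := by
  have h0 : ∫⁻ t in Set.Ioi (0 : ℝ), (if b ≤ t then ENNReal.ofReal (t ^ p) else 0) =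
      ∫⁻ t in Set.Ici b, ENNReal.ofReal (t ^ p) := by
    have : (fun t : ℝ => if b ≤ t then ENNReal.ofReal (t ^ p) else 0) =
        (Set.Ici b).indicator (fun t => ENNReal.ofReal (t ^ p)) := by
      ext t; simp [Set.indicator_apply]
    rw [this, setLIntegral_indicator measurableSet_Ici,
      Set.inter_eq_left.2 (Set.Ici_subset_Ioi.2 hb)]
  rw [h0, setLIntegral_congr Ioi_ae_eq_Ici.symm, ← ofReal_integral_eq_lintegral_ofReal]
  · rw [integral_Ioi_rpow_of_lt hp hb]
  · exact integrableOn_Ioi_rpow_of_lt hp hb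
  · filter_upwards [ae_restrict_mem measurableSet_Ioi] with t ht
    exact Real.rpow_nonneg (hb.trans ht).le _

theorem lintegral_enorm_rpow_eq {X : Type*} [MeasurableSpace X] (μ : Measure X) {F : X → ℂ}
    (hF : Measurable F) {s : ℝ} (hs : 0 < s) :
    ∫⁻ x, ‖F x‖ₑ ^ s ∂μ = ENNReal.ofReal s *
      ∫⁻ t in Set.Ioi (0 : ℝ), μ {x | t < ‖F x‖} * ENNReal.ofReal (t ^ (s - 1)) := by
  rw [← lintegral_rpow_eq_lintegral_meas_lt_mul μ (f := fun x => ‖F x‖)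
    (Filter.Eventually.of_forall fun x => norm_nonneg _) hF.norm.aemeasurable hs]
  refine lintegral_congr fun x => ?_
  rw [← ENNReal.ofReal_rpow_of_nonneg (norm_nonneg _) hs.le, ofReal_norm]

theorem measure_lt_norm_le_sq {X : Type*} [MeasurableSpace X] (μ : Measure X) {F : X → ℂ}
    (hF : Measurable F) {t : ℝ} (ht : 0 < t) :
    μ {x | t / 2 < ‖F x‖} ≤ ENNReal.ofReal (4 * t ^ (-2 : ℝ)) * ∫⁻ x, ‖F x‖ₑ ^ 2 ∂μ := by
  have h := mul_meas_ge_le_lintegral₀ (μ := μ) (f := fun x => ‖F x‖ₑ ^ 2)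
    (hF.enorm.pow_const 2).aemeasurable (ENNReal.ofReal ((t / 2) ^ 2))
  have h2 : {x | t / 2 < ‖F x‖} ⊆ {x | ENNReal.ofReal ((t / 2) ^ 2) ≤ ‖F x‖ₑ ^ 2} := by
    intro x hx
    simp only [Set.mem_ofPred_eq] at hx ⊢
    rw [ENNReal.ofReal_pow (by positivity), ← ofReal_norm]
    gcongr
  have e : ENNReal.ofReal (4 * t ^ (-2 : ℝ)) * ENNReal.ofReal ((t / 2) ^ 2) = 1 := by
    rw [← ENNReal.ofReal_mul (by positivity), Real.rpow_neg ht.le, Real.rpow_two,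
      ← ENNReal.ofReal_one]
    congr 1
    field_simp
    norm_num
  calc μ {x | t / 2 < ‖F x‖} ≤ 1 * μ {x | ENNReal.ofReal ((t / 2) ^ 2) ≤ ‖F x‖ₑ ^ 2} := by
        rw [one_mul]; exact measure_mono h2
    _ = ENNReal.ofReal (4 * t ^ (-2 : ℝ)) * (ENNReal.ofReal ((t / 2) ^ 2) *
          μ {x | ENNReal.ofReal ((t / 2) ^ 2) ≤ ‖F x‖ₑ ^ 2}) := by rw [← mul_assoc, e]
    _ ≤ _ := by gcongr

theorem measure_lt_norm_le_one {X : Type*} [MeasurableSpace X] (μ : Measure X) {F : X → ℂ}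
    (hF : Measurable F) {t : ℝ} (ht : 0 < t) :
    μ {x | t / 2 < ‖F x‖} ≤ ENNReal.ofReal (2 * t ^ (-1 : ℝ)) * ∫⁻ x, ‖F x‖ₑ ∂μ := by
  have h := mul_meas_ge_le_lintegral₀ (μ := μ) (f := fun x => ‖F x‖ₑ)
    hF.enorm.aemeasurable (ENNReal.ofReal (t / 2))
  have h2 : {x | t / 2 < ‖F x‖} ⊆ {x | ENNReal.ofReal (t / 2) ≤ ‖F x‖ₑ} := by
    intro x hx
    simp only [Set.mem_ofPred_eq] at hx ⊢
    rw [← ofReal_norm]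
    gcongr
  have e : ENNReal.ofReal (2 * t ^ (-1 : ℝ)) * ENNReal.ofReal (t / 2) = 1 := by
    rw [← ENNReal.ofReal_mul (by positivity), Real.rpow_neg ht.le, Real.rpow_one]
    norm_num
    field_simp
  calc μ {x | t / 2 < ‖F x‖} ≤ 1 * μ {x | ENNReal.ofReal (t / 2) ≤ ‖F x‖ₑ} := by
        rw [one_mul]; exact measure_mono h2
    _ = ENNReal.ofReal (2 * t ^ (-1 : ℝ)) * (ENNReal.ofReal (t / 2) *
          μ {x | ENNReal.ofReal (t / 2) ≤ ‖F x‖ₑ}) := by rw [← mul_assoc, e]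
    _ ≤ _ := by gcongr

/-- The entries of `f` of size larger than `b`. -/
noncomputable def largePart (b : ℝ) (f : ℤ → ℂ) (n : ℤ) : ℂ := if b < ‖f n‖ then f n else 0

/-- The entries of `f` of size at most `b`. -/
noncomputable def smallPart (b : ℝ) (f : ℤ → ℂ) (n : ℤ) : ℂ := if b < ‖f n‖ then 0 else f n

theorem smallPart_add_largePart (b : ℝ) (f : ℤ → ℂ) : smallPart b f + largePart b f = f := by
  ext n
  simp only [Pi.add_apply, smallPart, largePart]
  split_ifs <;> simp

theorem summable_largePart {f : ℤ → ℂ} (hf : Summable fun n => ‖f n‖) (b : ℝ) :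
    Summable fun n => ‖largePart b f n‖ := by
  refine hf.of_nonneg_of_le (fun n => norm_nonneg _) fun n => ?_
  unfold largePart; split_ifs <;> simp

theorem summable_smallPart {f : ℤ → ℂ} (hf : Summable fun n => ‖f n‖) (b : ℝ) :
    Summable fun n => ‖smallPart b f n‖ := by
  refine hf.of_nonneg_of_le (fun n => norm_nonneg _) fun n => ?_
  unfold smallPart; split_ifs <;> simp

theorem measure_lt_norm_add_le {X : Type*} [MeasurableSpace X] (μ : Measure X) (F G : X → ℂ)
    (t : ℝ) :
    μ {x | t < ‖(F + G) x‖} ≤ μ {x | t / 2 < ‖F x‖} + μ {x | t / 2 < ‖G x‖} := by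
  refine (measure_mono fun x hx => ?_).trans (measure_union_le _ _)
  simp only [Set.mem_ofPred_eq, Set.mem_union, Pi.add_apply] at hx ⊢
  by_contra! h
  linarith [norm_add_le (F x) (G x)]

/-- Marcinkiewicz interpolation between ℓ² and ℓ^∞, with the dependence on `A` explicit because `A`
will involve the divisor bound. Each height t has its own splitting of `f`, and the layer-cake
formula integrates the result. -/
theorem lintegral_rpow_le_of_two_top {X : Type*} [MeasurableSpace X] {μ : Measure X}
    {T : (ℤ → ℂ) → X → ℂ} {A s : ℝ} (hA : 0 < A) (hs : 2 < s)
    (hmeas : ∀ f, (Summable fun n => ‖f n‖) → Measurable (T f))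
    (hadd : ∀ f g, (Summable fun n => ‖f n‖) → (Summable fun n => ‖g n‖) → T (f + g) = T f + T g)
    (htop : ∀ f, (Summable fun n => ‖f n‖) → ∀ M, (∀ n, ‖f n‖ ≤ M) → ∀ x, ‖T f x‖ ≤ A * M)
    (htwo : ∀ f, (Summable fun n => ‖f n‖) → ∫⁻ x, ‖T f x‖ₑ ^ 2 ∂μ ≤ ∑' n, ‖f n‖ₑ ^ 2)
    {f : ℤ → ℂ} (hf : Summable fun n => ‖f n‖) :
    ∫⁻ x, ‖T f x‖ₑ ^ s ∂μ ≤
      ENNReal.ofReal (s * (4 * ((2 * A) ^ (s - 2) / (s - 2)))) * ∑' n, ‖f n‖ₑ ^ s := by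
  rw [lintegral_enorm_rpow_eq μ (hmeas f hf) (by linarith)]
  have key : ∀ t : ℝ, 0 < t → μ {x | t < ‖T f x‖} * ENNReal.ofReal (t ^ (s - 1)) ≤
      ∑' n, ENNReal.ofReal 4 * (‖f n‖ₑ ^ 2 *
        (if t < 2 * A * ‖f n‖ then ENNReal.ofReal (t ^ (s - 3)) else 0)) := by
    intro t ht
    -- At this threshold the small part has image at most t/2, so only the large part contributes,
    -- through Chebyshev in L².
    set b := t / (2 * A) with hb
    have hs1 := summable_smallPart hf b
    have hs2 := summable_largePart hf b
    have h1 : {x | t / 2 < ‖T (smallPart b f) x‖} = ∅ := by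
      ext x
      simp only [Set.mem_ofPred_eq, Set.mem_empty_iff_false, iff_false, not_lt]
      refine (htop _ hs1 b (fun n => ?_) x).trans (le_of_eq (by rw [hb]; field_simp))
      unfold smallPart
      split_ifs with h
      · simp only [norm_zero, hb]; positivity
      · exact not_lt.1 h
    calc μ {x | t < ‖T f x‖} * ENNReal.ofReal (t ^ (s - 1))
        ≤ (ENNReal.ofReal (4 * t ^ (-2 : ℝ)) * ∑' n, ‖largePart b f n‖ₑ ^ 2) *
            ENNReal.ofReal (t ^ (s - 1)) := by
          gcongr
          conv_lhs => rw [← smallPart_add_largePart b f, hadd _ _ hs1 hs2]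
          refine (measure_lt_norm_add_le μ _ _ t).trans ?_
          rw [h1, measure_empty, zero_add]
          exact (measure_lt_norm_le_sq μ (hmeas _ hs2) ht).trans (by gcongr; exact htwo _ hs2)
      _ = ∑' n, ENNReal.ofReal (4 * t ^ (s - 3)) * ‖largePart b f n‖ₑ ^ 2 := by
          rw [ENNReal.tsum_mul_left, mul_right_comm, ← ENNReal.ofReal_mul (by positivity),
            mul_assoc 4, ← Real.rpow_add ht]
          congr 4; ring
      _ = _ := by
          refine tsum_congr fun n => ?_
          have hiff : b < ‖f n‖ ↔ t < 2 * A * ‖f n‖ := by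
            rw [hb, div_lt_iff₀ (by positivity), mul_comm]
          simp only [largePart, hiff]
          split_ifs
          · rw [ENNReal.ofReal_mul (by norm_num)]; ring
          · simp
  calc ENNReal.ofReal s * ∫⁻ t in Set.Ioi (0 : ℝ), μ {x | t < ‖T f x‖} * ENNReal.ofReal (t ^ (s - 1))
      ≤ ENNReal.ofReal s * ∫⁻ t in Set.Ioi (0 : ℝ), ∑' n, ENNReal.ofReal 4 * (‖f n‖ₑ ^ 2 *
        (if t < 2 * A * ‖f n‖ then ENNReal.ofReal (t ^ (s - 3)) else 0)) := by
        gcongr 1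
        exact setLIntegral_mono' measurableSet_Ioi key
    _ = ENNReal.ofReal s * ∑' n, ENNReal.ofReal 4 * (‖f n‖ₑ ^ 2 *
          ENNReal.ofReal ((2 * A * ‖f n‖) ^ (s - 2) / (s - 2))) := by
        have hm : ∀ n, Measurable fun t : ℝ =>
            (if t < 2 * A * ‖f n‖ then ENNReal.ofReal (t ^ (s - 3)) else 0) := fun n =>
          Measurable.ite measurableSet_Iio (by fun_prop) (by fun_prop)
        rw [lintegral_tsum fun n => (((hm n).const_mul _).const_mul _).aemeasurable]
        congr 1
        refine tsum_congr fun n => ?_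
        rw [lintegral_const_mul _ ((hm n).const_mul _), lintegral_const_mul _ (hm n),
          lintegral_Ioi_ite_lt (by positivity) (by linarith)]
        congr 4 <;> ring_nf
    _ = _ := by
        rw [← ENNReal.tsum_mul_left, ← ENNReal.tsum_mul_left]
        refine tsum_congr fun n => ?_
        have hs2 : 0 < s - 2 := by linarith
        rw [Real.mul_rpow (by positivity) (by positivity), ← ofReal_norm,
          ENNReal.ofReal_rpow_of_nonneg (by positivity) (by linarith),
          ← ENNReal.ofReal_pow (by positivity), ← ENNReal.ofReal_mul (by positivity),
          ← ENNReal.ofReal_mul (by positivity), ← ENNReal.ofReal_mul (by positivity),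
          ← ENNReal.ofReal_mul (by positivity)]
        congr 1
        have : ‖f n‖ ^ s = ‖f n‖ ^ 2 * ‖f n‖ ^ (s - 2) := by
          rw [← Real.rpow_natCast, ← Real.rpow_add_of_nonneg (norm_nonneg _) (by norm_num) hs2.le]
          congr 1; push_cast; ring
        rw [this]; ring

/-- Marcinkiewicz interpolation between ℓ¹ and ℓ²: Chebyshev in L² for the small part and in L¹ for
the large part. -/
theorem lintegral_rpow_le_of_one_two {X : Type*} [MeasurableSpace X] {μ : Measure X}
    {T : (ℤ → ℂ) → X → ℂ} {A s : ℝ} (hA : 0 < A) (hs1 : 1 < s) (hs : s < 2)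
    (hmeas : ∀ f, (Summable fun n => ‖f n‖) → Measurable (T f))
    (hadd : ∀ f g, (Summable fun n => ‖f n‖) → (Summable fun n => ‖g n‖) → T (f + g) = T f + T g)
    (hone : ∀ f, (Summable fun n => ‖f n‖) →
      ∫⁻ x, ‖T f x‖ₑ ∂μ ≤ ENNReal.ofReal A * ∑' n, ‖f n‖ₑ)
    (htwo : ∀ f, (Summable fun n => ‖f n‖) → ∫⁻ x, ‖T f x‖ₑ ^ 2 ∂μ ≤ ∑' n, ‖f n‖ₑ ^ 2)
    {f : ℤ → ℂ} (hf : Summable fun n => ‖f n‖) :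
    ∫⁻ x, ‖T f x‖ₑ ^ s ∂μ ≤
      ENNReal.ofReal (s * ((4 / (2 - s) + 2 / (s - 1)) * A ^ (2 - s))) * ∑' n, ‖f n‖ₑ ^ s := by
  rw [lintegral_enorm_rpow_eq μ (hmeas f hf) (by linarith)]
  have key : ∀ t : ℝ, 0 < t → μ {x | t < ‖T f x‖} * ENNReal.ofReal (t ^ (s - 1)) ≤
      ∑' n, (ENNReal.ofReal 4 * (‖f n‖ₑ ^ 2 *
        (if ‖f n‖ / A ≤ t then ENNReal.ofReal (t ^ (s - 3)) else 0)) +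
        ENNReal.ofReal (2 * A) * (‖f n‖ₑ *
        (if t < ‖f n‖ / A then ENNReal.ofReal (t ^ (s - 2)) else 0))) := by
    intro t ht
    -- This threshold balances the parts: after integration in t both are multiples of A^(2-s) ‖f
    -- n‖^s.
    set b := t * A with hb
    have hs1 := summable_smallPart hf b
    have hs2 := summable_largePart hf b
    calc μ {x | t < ‖T f x‖} * ENNReal.ofReal (t ^ (s - 1))
        ≤ (ENNReal.ofReal (4 * t ^ (-2 : ℝ)) * ∑' n, ‖smallPart b f n‖ₑ ^ 2 +
          ENNReal.ofReal (2 * t ^ (-1 : ℝ)) * (ENNReal.ofReal A * ∑' n, ‖largePart b f n‖ₑ)) *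
            ENNReal.ofReal (t ^ (s - 1)) := by
          gcongr
          conv_lhs => rw [← smallPart_add_largePart b f, hadd _ _ hs1 hs2]
          refine (measure_lt_norm_add_le μ _ _ t).trans (add_le_add ?_ ?_)
          · exact (measure_lt_norm_le_sq μ (hmeas _ hs1) ht).trans (by gcongr; exact htwo _ hs1)
          · exact (measure_lt_norm_le_one μ (hmeas _ hs2) ht).trans (by gcongr; exact hone _ hs2)
      _ = ∑' n, (ENNReal.ofReal (4 * t ^ (s - 3)) * ‖smallPart b f n‖ₑ ^ 2 +
            ENNReal.ofReal (2 * A * t ^ (s - 2)) * ‖largePart b f n‖ₑ) := by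
          have e1 : 4 * t ^ (-2 : ℝ) * t ^ (s - 1) = 4 * t ^ (s - 3) := by
            rw [mul_assoc, ← Real.rpow_add ht]; congr 2; ring
          have e2 : 2 * t ^ (-1 : ℝ) * A * t ^ (s - 1) = 2 * A * t ^ (s - 2) := by
            rw [show s - 2 = -1 + (s - 1) by ring, Real.rpow_add ht]; ring
          rw [ENNReal.tsum_add, ENNReal.tsum_mul_left, ENNReal.tsum_mul_left, add_mul,
            mul_right_comm, ← ENNReal.ofReal_mul (by positivity), ← mul_assoc,
            ← ENNReal.ofReal_mul (by positivity), mul_right_comm (ENNReal.ofReal (_ * A)),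
            ← ENNReal.ofReal_mul (by positivity), e1, e2]
      _ = _ := by
          refine tsum_congr fun n => ?_
          have hiff : b < ‖f n‖ ↔ t < ‖f n‖ / A := by
            rw [hb, lt_div_iff₀ hA]
          simp only [largePart, smallPart, hiff]
          by_cases h : t < ‖f n‖ / A
          · rw [if_pos h, if_pos h, if_pos h, if_neg (not_le.2 h),
              ENNReal.ofReal_mul (p := 2 * A) (by positivity)]
            simp only [enorm_zero, ne_eq, OfNat.ofNat_ne_zero, not_false_eq_true, zero_pow,
              mul_zero, zero_add]
            ring
          · rw [if_neg h, if_neg h, if_neg h, if_pos (not_lt.1 h),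
              ENNReal.ofReal_mul (p := 4) (by positivity)]
            simp only [enorm_zero, mul_zero, add_zero]
            ring
  calc ENNReal.ofReal s * ∫⁻ t in Set.Ioi (0 : ℝ), μ {x | t < ‖T f x‖} * ENNReal.ofReal (t ^ (s - 1))
      ≤ ENNReal.ofReal s * ∫⁻ t in Set.Ioi (0 : ℝ), ∑' n, (ENNReal.ofReal 4 * (‖f n‖ₑ ^ 2 *
        (if ‖f n‖ / A ≤ t then ENNReal.ofReal (t ^ (s - 3)) else 0)) +
        ENNReal.ofReal (2 * A) * (‖f n‖ₑ *
        (if t < ‖f n‖ / A then ENNReal.ofReal (t ^ (s - 2)) else 0))) := by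
        gcongr 1
        exact setLIntegral_mono' measurableSet_Ioi key
    _ ≤ ENNReal.ofReal s * ∑' n, ENNReal.ofReal ((4 / (2 - s) + 2 / (s - 1)) * A ^ (2 - s)) *
          ‖f n‖ₑ ^ s := by
        have hm1 : ∀ n, Measurable fun t : ℝ =>
            (if ‖f n‖ / A ≤ t then ENNReal.ofReal (t ^ (s - 3)) else 0) := fun n =>
          Measurable.ite measurableSet_Ici (by fun_prop) (by fun_prop)
        have hm2 : ∀ n, Measurable fun t : ℝ =>
            (if t < ‖f n‖ / A then ENNReal.ofReal (t ^ (s - 2)) else 0) := fun n =>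
          Measurable.ite measurableSet_Iio (by fun_prop) (by fun_prop)
        have hm3 : ∀ n, AEMeasurable (fun t : ℝ => ENNReal.ofReal 4 * (‖f n‖ₑ ^ 2 *
            (if ‖f n‖ / A ≤ t then ENNReal.ofReal (t ^ (s - 3)) else 0)) +
            ENNReal.ofReal (2 * A) * (‖f n‖ₑ *
            (if t < ‖f n‖ / A then ENNReal.ofReal (t ^ (s - 2)) else 0)))
            (volume.restrict (Set.Ioi 0)) := fun n =>
          ((((hm1 n).const_mul _).const_mul _).add
            (((hm2 n).const_mul _).const_mul _)).aemeasurable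
        rw [lintegral_tsum hm3]
        gcongr with n
        rw [lintegral_add_left (((hm1 n).const_mul _).const_mul _),
          lintegral_const_mul _ ((hm1 n).const_mul _), lintegral_const_mul _ (hm1 n),
          lintegral_const_mul _ ((hm2 n).const_mul _), lintegral_const_mul _ (hm2 n)]
        rcases eq_or_ne (f n) 0 with h0 | h0
        · simp [h0]
        have hpos : 0 < ‖f n‖ := norm_pos_iff.2 h0
        have hs2' : 0 < 2 - s := by linarith
        have hs1' : 0 < s - 1 := by linarith
        rw [lintegral_Ioi_ite_lt (by positivity) (by linarith),
          lintegral_Ioi_ite_le (by positivity) (by linarith), ← ofReal_norm,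
          ENNReal.ofReal_rpow_of_nonneg (by positivity) (by linarith),
          ← ENNReal.ofReal_pow (by positivity), ← ENNReal.ofReal_mul (by positivity),
          ← ENNReal.ofReal_mul (by positivity), ← ENNReal.ofReal_mul (by positivity),
          ← ENNReal.ofReal_mul (by positivity), ← ENNReal.ofReal_mul (by positivity),
          ← ENNReal.ofReal_add]
        · refine ENNReal.ofReal_le_ofReal (le_of_eq ?_)
          have x1 : ‖f n‖ ^ s = ‖f n‖ ^ 2 * ‖f n‖ ^ (s - 2) := by
            rw [← Real.rpow_natCast, ← Real.rpow_add hpos]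
            congr 1; push_cast; ring
          have x2 : ‖f n‖ ^ s = ‖f n‖ * ‖f n‖ ^ (s - 1) := by
            rw [← Real.rpow_one_add' hpos.le (by linarith)]
            congr 1; ring
          have y1 : A ^ (s - 2) = (A ^ (2 - s))⁻¹ := by
            rw [← Real.rpow_neg hA.le]; congr 1; ring
          have y2 : A * (A ^ (s - 1))⁻¹ = A ^ (2 - s) := by
            rw [← Real.rpow_neg hA.le, ← Real.rpow_one_add' hA.le (by linarith)]; congr 1; ring
          rw [show s - 3 + 1 = s - 2 by ring, show s - 2 + 1 = s - 1 by ring,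
            Real.div_rpow hpos.le hA.le, Real.div_rpow hpos.le hA.le, add_mul, add_mul]
          congr 1
          · rw [x1, y1, show s - 2 = -(2 - s) by ring]
            field_simp
          · rw [x2, ← y2]
            field_simp
        · have : 0 ≤ -(‖f n‖ / A) ^ (s - 3 + 1) / (s - 3 + 1) := by
            apply div_nonneg_of_nonpos
            · simp only [Left.neg_nonpos_iff]; positivity
            · linarith
          positivity
        · have : 0 < s - 2 + 1 := by linarith
          positivity
    _ = _ := by
        rw [ENNReal.tsum_mul_left, ← mul_assoc, ← ENNReal.ofReal_mul (by positivity)]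

/-! ### Ramanujan sums, the totient and the divisor function -/

theorem fourier_natCast_div (m : ℤ) (a q : ℕ) :
    fourier m (((a : ℝ) / q : ℝ) : UnitAddCircle) =
      fourier m (((1 : ℝ) / q : ℝ) : UnitAddCircle) ^ a := by
  rw [fourier_coe_apply, fourier_coe_apply, ← Complex.exp_nat_mul]
  congr 1
  push_cast
  ring

theorem fourier_one_div_pow {q : ℕ} (hq : 0 < q) (m : ℤ) :
    fourier m (((1 : ℝ) / q : ℝ) : UnitAddCircle) ^ q = 1 := by
  rw [fourier_coe_apply, ← Complex.exp_nat_mul, Complex.exp_eq_one_iff]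
  refine ⟨m, ?_⟩
  have : (q : ℂ) ≠ 0 := by exact_mod_cast hq.ne'
  push_cast
  field_simp

theorem fourier_one_div_eq_one_iff {q : ℕ} (hq : 0 < q) (m : ℤ) :
    fourier m (((1 : ℝ) / q : ℝ) : UnitAddCircle) = 1 ↔ (q : ℤ) ∣ m := by
  have hq' : (q : ℂ) ≠ 0 := by exact_mod_cast hq.ne'
  rw [fourier_coe_apply, Complex.exp_eq_one_iff]
  constructor
  · rintro ⟨n, hn⟩
    refine ⟨n, ?_⟩
    have h2 : (2 * Real.pi * Complex.I : ℂ) ≠ 0 := Complex.two_pi_I_ne_zero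
    have h3 : (2 * Real.pi * Complex.I : ℂ) * m = (2 * Real.pi * Complex.I : ℂ) * (q * n) := by
      push_cast at hn
      field_simp at hn
      linear_combination (2 * Real.pi * Complex.I : ℂ) * hn
    exact_mod_cast mul_left_cancel₀ h2 h3
  · rintro ⟨n, rfl⟩
    refine ⟨n, ?_⟩
    push_cast
    field_simp

theorem sum_range_fourier_div {q : ℕ} (hq : 0 < q) (m : ℤ) :
    ∑ a ∈ Finset.range q, fourier m (((a : ℝ) / q : ℝ) : UnitAddCircle) =
      if (q : ℤ) ∣ m then (q : ℂ) else 0 := by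
  simp only [fourier_natCast_div]
  split_ifs with h
  · rw [(fourier_one_div_eq_one_iff hq m).2 h]; simp
  · rw [geom_sum_eq (mt (fourier_one_div_eq_one_iff hq m).1 h), fourier_one_div_pow hq]; simp

theorem norm_sum_Icc_fourier_div_le {q : ℕ} (hq : 0 < q) (m : ℤ) :
    ‖∑ a ∈ Finset.Icc 1 q, fourier m (((a : ℝ) / q : ℝ) : UnitAddCircle)‖ ≤
      if (q : ℤ) ∣ m then (q : ℝ) else 0 := by
  have h1 : ∑ a ∈ Finset.Icc 1 q, fourier m (((a : ℝ) / q : ℝ) : UnitAddCircle) =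
      ∑ a ∈ Finset.range q, fourier m (((a : ℝ) / q : ℝ) : UnitAddCircle) := by
    rw [← Finset.Ico_add_one_right_eq_Icc, Finset.sum_Ico_eq_sum_range]
    simp only [fourier_natCast_div, Nat.add_sub_cancel, pow_add, ← Finset.mul_sum]
    by_cases h : fourier m (((1 : ℝ) / q : ℝ) : UnitAddCircle) = 1
    · rw [h]; simp
    · rw [geom_sum_eq h, fourier_one_div_pow hq]; simp
  rw [h1, sum_range_fourier_div hq]
  split_ifs <;> simp

/-- The Ramanujan sum `c_q(m) = ∑_{1 ≤ a ≤ q, (a, q) = 1} e^{2πiam/q}`. -/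
noncomputable def ramanujanSum (q : ℕ) (m : ℤ) : ℂ :=
  ∑ a ∈ (Finset.Icc 1 q).filter (fun a => a.Coprime q),
    fourier m (((a : ℝ) / q : ℝ) : UnitAddCircle)

/-- Coprimality is detected by the sum of μ(e) over e dividing gcd(a, q); then a = e b. -/
theorem sum_coprime_eq_sum_divisors {q : ℕ} (hq : 0 < q) (g : ℕ → ℂ) :
    ∑ a ∈ (Finset.Icc 1 q).filter (fun a => a.Coprime q), g a =
      ∑ e ∈ q.divisors, (ArithmeticFunction.moebius e : ℂ) *
        ∑ b ∈ Finset.Icc 1 (q / e), g (e * b) := by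
  have h1 : ∀ a ∈ Finset.Icc 1 q, (if a.Coprime q then g a else 0) =
      ∑ e ∈ q.divisors, if e ∣ a then (ArithmeticFunction.moebius e : ℂ) * g a else 0 := by
    intro a ha
    have h2 := congrArg (fun f : ArithmeticFunction ℤ => f (a.gcd q))
      ArithmeticFunction.moebius_mul_coe_zeta
    simp only [ArithmeticFunction.coe_mul_zeta_apply, ArithmeticFunction.one_apply] at h2
    have h3 : (a.gcd q).divisors = q.divisors.filter (fun e => e ∣ a) := by
      ext e
      simp only [Nat.mem_divisors, Finset.mem_filter, Nat.dvd_gcd_iff]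
      have : a.gcd q ≠ 0 := (Nat.gcd_pos_of_pos_right _ hq).ne'
      have := hq.ne'
      tauto
    rw [← Finset.sum_filter, ← h3, ← Finset.sum_mul]
    have h4 : (∑ e ∈ (a.gcd q).divisors, (ArithmeticFunction.moebius e : ℂ)) =
        if a.gcd q = 1 then 1 else 0 := by
      exact_mod_cast congrArg (Int.cast : ℤ → ℂ) h2
    rw [h4]
    simp only [Nat.Coprime]
    split_ifs <;> simp
  rw [Finset.sum_filter, Finset.sum_congr rfl h1, Finset.sum_comm]
  refine Finset.sum_congr rfl fun e he => ?_
  obtain ⟨k, rfl⟩ := Nat.dvd_of_mem_divisors he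
  have he0 : 0 < e := Nat.pos_of_mem_divisors he
  rw [← Finset.sum_filter, ← Finset.mul_sum, Nat.mul_div_cancel_left _ he0]
  congr 1
  symm
  refine Finset.sum_nbij' (fun b => e * b) (fun a => a / e) ?_ ?_ ?_ ?_ ?_
  · intro b hb
    simp only [Finset.mem_Icc, Finset.mem_filter] at hb ⊢
    exact ⟨⟨Nat.mul_pos he0 hb.1, Nat.mul_le_mul_left _ hb.2⟩, dvd_mul_right _ _⟩
  · intro a ha
    simp only [Finset.mem_Icc, Finset.mem_filter] at ha ⊢
    obtain ⟨⟨h1, h2⟩, b, rfl⟩ := ha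
    rw [Nat.mul_div_cancel_left _ he0]
    exact ⟨Nat.pos_of_mul_pos_left h1, Nat.le_of_mul_le_mul_left h2 he0⟩
  · intro b hb; exact Nat.mul_div_cancel_left _ he0
  · intro a ha
    exact Nat.mul_div_cancel' (Finset.mem_filter.1 ha).2
  · intro b hb; rfl

theorem card_filter_dvd_add {d q : ℕ} (hd : 0 < d) (hdq : d ∣ q) (z : ℤ) :
    ((Finset.range q).filter (fun j : ℕ => (d : ℤ) ∣ j + z)).card = q / d := by
  have hv : ((((-z) % d).toNat : ℕ) : ℤ) = (-z) % d :=
    Int.toNat_of_nonneg (Int.emod_nonneg _ (by exact_mod_cast hd.ne'))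
  have h := Nat.count_modEq_card (b := q) hd (((-z) % d).toNat)
  rw [Nat.mod_eq_zero_of_dvd hdq, if_neg (by simp), add_zero, Nat.count_eq_card_filter_range] at h
  rw [← h]
  congr 1
  refine Finset.filter_congr fun j _ => ?_
  rw [← Int.natCast_modEq_iff, hv]
  constructor
  · intro h1
    have h2 : (j : ℤ) ≡ -z [ZMOD d] := (Int.modEq_iff_dvd.2 (by
      rw [show -z - (j : ℤ) = -(j + z) by ring, dvd_neg]; exact h1))
    exact h2.trans (Int.mod_modEq _ _).symm
  · intro h1
    have h2 := Int.modEq_iff_dvd.1 (h1.trans (Int.mod_modEq _ _))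
    rwa [show -z - (j : ℤ) = -(j + z) by ring, dvd_neg] at h2

/-- Möbius inversion writes c_q as a sum over e | q of ±1 or 0 times (q/e) 1_{(q/e) | m}, and each
such term has absolute sum at most q over a period. The trivial bound would give φ(q) where this
gives d(q), and no decay would survive. -/
theorem sum_norm_ramanujanSum_le {q : ℕ} (hq : 0 < q) (z : ℤ) :
    ∑ j ∈ Finset.range q, ‖ramanujanSum q (j + z)‖ ≤ q * q.divisors.card := by
  have h1 : ∀ m : ℤ, ‖ramanujanSum q m‖ ≤ ∑ e ∈ q.divisors,
      if ((q / e : ℕ) : ℤ) ∣ m then ((q / e : ℕ) : ℝ) else 0 := by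
    intro m
    rw [ramanujanSum, sum_coprime_eq_sum_divisors hq]
    refine (norm_sum_le _ _).trans (Finset.sum_le_sum fun e he => ?_)
    have he0 : 0 < e := Nat.pos_of_mem_divisors he
    have hk0 : 0 < q / e := Nat.div_pos (Nat.divisor_le he) he0
    rw [norm_mul]
    have hμ : ‖(ArithmeticFunction.moebius e : ℂ)‖ ≤ 1 := by
      rw [Complex.norm_intCast]
      exact_mod_cast ArithmeticFunction.abs_moebius_le_one
    refine le_trans (mul_le_of_le_one_left (norm_nonneg _) hμ) ?_
    refine le_trans (le_of_eq ?_) (norm_sum_Icc_fourier_div_le hk0 m)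
    congr 1
    refine Finset.sum_congr rfl fun b _ => ?_
    have hqe : ((e * b : ℕ) : ℝ) / (q : ℝ) = (b : ℝ) / ((q / e : ℕ) : ℝ) := by
      obtain ⟨k, rfl⟩ := Nat.dvd_of_mem_divisors he
      rw [Nat.mul_div_cancel_left _ he0] at hk0 ⊢
      have : (e : ℝ) ≠ 0 := by exact_mod_cast he0.ne'
      have : (k : ℝ) ≠ 0 := by exact_mod_cast hk0.ne'
      push_cast
      field_simp
    rw [hqe]
  calc ∑ j ∈ Finset.range q, ‖ramanujanSum q (j + z)‖
      ≤ ∑ j ∈ Finset.range q, ∑ e ∈ q.divisors,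
          (if ((q / e : ℕ) : ℤ) ∣ (j + z) then ((q / e : ℕ) : ℝ) else 0) :=
        Finset.sum_le_sum fun j _ => h1 _
    _ = ∑ e ∈ q.divisors, (q : ℝ) := by
        rw [Finset.sum_comm]
        refine Finset.sum_congr rfl fun e he => ?_
        have he0 : 0 < e := Nat.pos_of_mem_divisors he
        have hed := Nat.dvd_of_mem_divisors he
        have hk0 : 0 < q / e := Nat.div_pos (Nat.divisor_le he) he0
        rw [← Finset.sum_filter, Finset.sum_const,
          card_filter_dvd_add hk0 (Nat.div_dvd_of_dvd hed), Nat.div_div_self hed hq.ne',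
          nsmul_eq_mul, ← Nat.cast_mul, Nat.mul_div_cancel' hed]
    _ = _ := by rw [Finset.sum_const, nsmul_eq_mul, mul_comm]

theorem norm_ramanujanSum_neg (q : ℕ) (m : ℤ) : ‖ramanujanSum q (-m)‖ = ‖ramanujanSum q m‖ := by
  rw [← Complex.norm_conj (ramanujanSum q m), ramanujanSum, ramanujanSum, map_sum]
  simp only [fourier_neg]

/-- All factors are multiplicative, and at p^n the claim is p ≤ (p - 1)(n + 1). It bounds 1/φ(q) by
d(q)/q. -/
theorem le_totient_mul_card_divisors (q : ℕ) : q ≤ q.totient * q.divisors.card := by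
  induction q using Nat.recOnPosPrimePosCoprime with
  | prime_pow p n hp hn =>
    rw [Nat.totient_prime_pow hp hn, Nat.divisors_prime_pow hp, Finset.card_map, Finset.card_range]
    obtain ⟨k, rfl⟩ : ∃ k, n = k + 1 := ⟨n - 1, by omega⟩
    obtain ⟨j, rfl⟩ : ∃ j, p = j + 2 := ⟨p - 2, by have := hp.two_le; omega⟩
    rw [pow_succ, Nat.add_sub_cancel, mul_assoc]
    refine Nat.mul_le_mul_left _ ?_
    simp only [Nat.add_succ_sub_one]
    nlinarith
  | zero => simp
  | one => simp
  | coprime a b ha hb hab iha ihb =>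
    rw [Nat.totient_mul hab, hab.card_divisors_mul]
    calc a * b ≤ (a.totient * a.divisors.card) * (b.totient * b.divisors.card) :=
          Nat.mul_le_mul iha ihb
      _ = _ := by ring

/-- Each prime factor contributes 2 to d(q). If p ≥ 2^K then 2 ≤ p^(1/K); fewer than 2^K primes
remain, giving the constant. -/
theorem card_divisors_le_of_squarefree {K : ℕ} (hK : 0 < K) {q : ℕ} (hq : Squarefree q) :
    (q.divisors.card : ℝ) ≤ 2 ^ (2 ^ K) * (q : ℝ) ^ (1 / (K : ℝ)) := by
  have hK' : (0 : ℝ) < K := by exact_mod_cast hK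
  have h1 : q.divisors.card = ∏ p ∈ q.primeFactors, 2 := by
    rw [Nat.card_divisors hq.ne_zero]
    refine Finset.prod_congr rfl fun p hp => ?_
    have := hq.natFactorization_le_one p
    have := (Nat.prime_of_mem_primeFactors hp).factorization_pos_of_dvd hq.ne_zero
      (Nat.dvd_of_mem_primeFactors hp)
    omega
  have h2 : (q : ℝ) = ∏ p ∈ q.primeFactors, (p : ℝ) := by
    rw [← Nat.cast_prod, Nat.prod_primeFactors_of_squarefree hq]
  rw [h1]
  conv_rhs => rw [h2]
  rw [← Real.finsetProd_rpow _ _ (fun p _ => by positivity)]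
  push_cast
  calc ∏ p ∈ q.primeFactors, (2 : ℝ)
      ≤ ∏ p ∈ q.primeFactors, ((if p < 2 ^ K then 2 else 1) * (p : ℝ) ^ (1 / (K : ℝ))) := by
        refine Finset.prod_le_prod (fun _ _ => by norm_num) fun p hp => ?_
        have hp1 : (1 : ℝ) ≤ p := by exact_mod_cast (Nat.prime_of_mem_primeFactors hp).one_le
        split_ifs with h
        · have := Real.one_le_rpow hp1 (z := 1 / (K : ℝ)) (by positivity)
          linarith
        · have h3 : ((2 : ℝ) ^ K) ≤ p := by exact_mod_cast not_lt.1 h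
          calc (2 : ℝ) = ((2 : ℝ) ^ K) ^ (1 / (K : ℝ)) := by
                rw [← Real.rpow_natCast, ← Real.rpow_mul (by norm_num),
                  mul_one_div_cancel hK'.ne', Real.rpow_one]
            _ ≤ (p : ℝ) ^ (1 / (K : ℝ)) := by gcongr
            _ = _ := by ring
    _ = (∏ p ∈ q.primeFactors, (if p < 2 ^ K then 2 else 1)) *
          ∏ p ∈ q.primeFactors, (p : ℝ) ^ (1 / (K : ℝ)) := Finset.prod_mul_distrib
    _ ≤ _ := by
        refine mul_le_mul_of_nonneg_right ?_ (Finset.prod_nonneg fun p _ => by positivity)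
        rw [← Finset.prod_filter, Finset.prod_const]
        refine pow_le_pow_right₀ (by norm_num) ?_
        calc _ ≤ (Finset.range (2 ^ K)).card := Finset.card_le_card fun p hp => by
              simpa using (Finset.mem_filter.1 hp).2
          _ = 2 ^ K := Finset.card_range _

theorem exists_card_divisors_le {ε : ℝ} (hε : 0 < ε) :
    ∃ C : ℝ, 1 ≤ C ∧ ∀ q : ℕ, Squarefree q → (q.divisors.card : ℝ) ≤ C * (q : ℝ) ^ ε := by
  obtain ⟨K, hK⟩ := exists_nat_gt (1 / ε)
  have hK0 : (0 : ℝ) < K := lt_trans (by positivity) hK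
  refine ⟨2 ^ (2 ^ K), one_le_pow₀ (by norm_num), fun q hq => ?_⟩
  refine (card_divisors_le_of_squarefree (by exact_mod_cast hK0) hq).trans ?_
  gcongr
  · exact_mod_cast Nat.one_le_iff_ne_zero.2 hq.ne_zero
  · rw [div_le_iff₀ hK0]
    rw [div_lt_iff₀ hε] at hK
    linarith

/-! ### Fourier series of sequences and the Ramanujan twist -/

theorem fourier_add_apply (n : ℤ) (x y : UnitAddCircle) :
    fourier n (x + y) = fourier n x * fourier n y := by
  simp only [fourier_apply, smul_add, AddCircle.toCircle_add, Circle.coe_mul]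

theorem norm_fourier_apply (n : ℤ) (x : UnitAddCircle) : ‖fourier n x‖ = 1 := by
  rw [fourier_apply]; exact Circle.norm_coe _

theorem ramanujanSum_add_mul {q : ℕ} (hq : 0 < q) (m k : ℤ) :
    ramanujanSum q (m + k * q) = ramanujanSum q m := by
  refine Finset.sum_congr rfl fun a _ => ?_
  rw [fourier_natCast_div, fourier_natCast_div, fourier_add,
    (fourier_one_div_eq_one_iff hq (k * q)).2 (dvd_mul_left _ _), mul_one]

theorem norm_ramanujanSum_le (q : ℕ) (m : ℤ) : ‖ramanujanSum q m‖ ≤ q := by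
  refine (norm_sum_le _ _).trans ?_
  simp only [norm_fourier_apply, Finset.sum_const, nsmul_eq_mul, mul_one]
  exact_mod_cast (Finset.card_filter_le _ _).trans (by simp)

/-- The sequence `n ↦ c_q(n - l) f(n)`. -/
noncomputable def twist (q : ℕ) (l : ℤ) (f : ℤ → ℂ) (n : ℤ) : ℂ := ramanujanSum q (n - l) * f n

theorem summable_twist (q : ℕ) (l : ℤ) {f : ℤ → ℂ} (hf : Summable fun n => ‖f n‖) :
    Summable fun n => ‖twist q l f n‖ := by
  refine (hf.mul_left (q : ℝ)).of_nonneg_of_le (fun n => norm_nonneg _) fun n => ?_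
  rw [twist, norm_mul]
  exact mul_le_mul_of_nonneg_right (norm_ramanujanSum_le _ _) (norm_nonneg _)

theorem twist_add (q : ℕ) (l : ℤ) (f g : ℤ → ℂ) : twist q l (f + g) = twist q l f + twist q l g := by
  ext n; simp [twist, mul_add]

theorem summable_seqFourier {f : ℤ → ℂ} (hf : Summable fun n => ‖f n‖) (ξ : UnitAddCircle) :
    Summable fun n => f n * fourier n ξ :=
  Summable.of_norm (by simpa only [norm_mul, norm_fourier_apply, mul_one] using hf)

theorem seqFourier_add {f g : ℤ → ℂ} (hf : Summable fun n => ‖f n‖) (hg : Summable fun n => ‖g n‖)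
    (ξ : UnitAddCircle) : seqFourier (f + g) ξ = seqFourier f ξ + seqFourier g ξ := by
  simp only [seqFourier, Pi.add_apply, add_mul]
  exact (summable_seqFourier hf ξ).tsum_add (summable_seqFourier hg ξ)

theorem continuous_seqFourier {f : ℤ → ℂ} (hf : Summable fun n => ‖f n‖) :
    Continuous (seqFourier f) :=
  continuous_tsum (fun n => continuous_const.mul (fourier n).continuous) hf
    fun n ξ => by simp only [norm_mul, norm_fourier_apply, mul_one, le_refl]

theorem norm_seqFourier_le {f : ℤ → ℂ} (hf : Summable fun n => ‖f n‖) (ξ : UnitAddCircle) :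
    ‖seqFourier f ξ‖ ≤ ∑' n, ‖f n‖ :=
  tsum_of_norm_bounded hf.hasSum fun n => by simp only [norm_mul, norm_fourier_apply, mul_one, le_refl]

theorem fourierCoeff_seqFourier {f : ℤ → ℂ} (hf : Summable fun n => ‖f n‖) (m : ℤ) :
    fourierCoeff (seqFourier f) m = f m := by
  have h1 : ∀ n, Integrable (fun ξ : UnitAddCircle => fourier (-m) ξ • (f n * fourier n ξ))
      AddCircle.haarAddCircle := fun n =>
    (Continuous.integrable_of_hasCompactSupport (by fun_prop)
      (HasCompactSupport.of_compactSpace _))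
  have h2 := integral_tsum_of_summable_integral_norm h1 (by
    simpa only [norm_smul, norm_mul, norm_fourier_apply, mul_one, one_mul, integral_const,
      probReal_univ, one_smul] using hf)
  have h3 : ∀ n, ∫ ξ : UnitAddCircle, fourier (-m) ξ • (f n * fourier n ξ)
      ∂AddCircle.haarAddCircle = if n = m then f m else 0 := by
    intro n
    have h4 := congrFun (fourierCoeff_fourier (T := 1) n) m
    rw [fourierCoeff] at h4
    simp only [smul_eq_mul, mul_left_comm _ (f n)] at h4 ⊢
    rw [integral_const_mul, h4, Pi.single_apply]
    by_cases h : n = m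
    · rw [if_pos h, if_pos h.symm, mul_one, h]
    · rw [if_neg h, if_neg (Ne.symm h), mul_zero]
  rw [fourierCoeff]
  simp only [h3, tsum_ite_eq] at h2
  rw [h2]
  refine integral_congr_ae (Filter.Eventually.of_forall fun ξ => ?_)
  simp only [seqFourier, smul_eq_mul]
  rw [tsum_mul_left]

theorem lintegral_enorm_seqFourier_sq {f : ℤ → ℂ} (hf : Summable fun n => ‖f n‖) (a : ℝ) :
    ∫⁻ ξ in Set.Ioc a (a + 1), ‖seqFourier f (ξ : UnitAddCircle)‖ₑ ^ 2 = ∑' n, ‖f n‖ₑ ^ 2 := by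
  rw [UnitAddCircle.lintegral_preimage a (fun ξ : UnitAddCircle => ‖seqFourier f ξ‖ₑ ^ 2)]
  have hvol : (volume : Measure UnitAddCircle) = AddCircle.haarAddCircle := by
    rw [AddCircle.volume_eq_smul_haarAddCircle]; simp
  have hmem : MemLp (seqFourier f) 2 (AddCircle.haarAddCircle (T := 1)) :=
    (continuous_seqFourier hf).memLp_of_hasCompactSupport (HasCompactSupport.of_compactSpace _)
  have h1 := hasSum_sq_fourierCoeff (hmem.toLp _)
  have h2 : ∀ n, fourierCoeff (hmem.toLp (seqFourier f)) n = f n := fun n => by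
    rw [fourierCoeff_congr_ae hmem.coeFn_toLp, fourierCoeff_seqFourier hf]
  have h3 : ∫ ξ, ‖(hmem.toLp (seqFourier f)) ξ‖ ^ 2 ∂AddCircle.haarAddCircle =
      ∫ ξ, ‖seqFourier f ξ‖ ^ 2 ∂AddCircle.haarAddCircle := by
    refine integral_congr_ae ?_
    filter_upwards [hmem.coeFn_toLp] with ξ hξ
    rw [hξ]
  simp only [h2, h3] at h1
  have h4 : Integrable (fun ξ => ‖seqFourier f ξ‖ ^ 2) (AddCircle.haarAddCircle (T := 1)) :=
    hmem.integrable_norm_pow (by norm_num)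
  have h5 : ∀ z : ℂ, ‖z‖ₑ ^ 2 = ENNReal.ofReal (‖z‖ ^ 2) := fun z => by
    rw [ENNReal.ofReal_pow (norm_nonneg _), ofReal_norm]
  simp only [h5]
  rw [hvol, ← ofReal_integral_eq_lintegral_ofReal h4 (Filter.Eventually.of_forall fun ξ => by positivity),
    ← h1.tsum_eq, ENNReal.ofReal_tsum_of_nonneg (fun n => by positivity) h1.summable]

/-- A character e(na/q) on the sequence is a translation of its Fourier series by a/q, so the twist
gathers all arcs of denominator q at the origin. -/
theorem seqFourier_twist {f : ℤ → ℂ} (hf : Summable fun n => ‖f n‖) (q : ℕ) (l : ℤ)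
    (ξ : UnitAddCircle) :
    seqFourier (twist q l f) ξ = ∑ a ∈ (Finset.Icc 1 q).filter (fun a => a.Coprime q),
      fourier (-l) (((a : ℝ) / q : ℝ) : UnitAddCircle) *
        seqFourier f (ξ + (((a : ℝ) / q : ℝ) : UnitAddCircle)) := by
  simp only [seqFourier, ← tsum_mul_left]
  rw [← Summable.tsum_finsetSum (fun a _ => (summable_seqFourier hf _).mul_left _)]
  refine tsum_congr fun n => ?_
  rw [twist, ramanujanSum, Finset.sum_mul, Finset.sum_mul]
  refine Finset.sum_congr rfl fun a _ => ?_
  rw [fourier_add_apply, sub_eq_add_neg, fourier_add]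
  ring

/-- Parseval on ℤ/q; elements of [1, q] are pairwise incongruent, so only diagonal terms survive. -/
theorem sum_range_norm_sq_fourier_div {q : ℕ} (hq : 0 < q) {A : Finset ℕ} (hA : A ⊆ Finset.Icc 1 q)
    (b : ℕ → ℂ) :
    ∑ l ∈ Finset.range q, ‖∑ a ∈ A, fourier (-(l : ℤ)) (((a : ℝ) / q : ℝ) : UnitAddCircle) * b a‖ ^ 2 =
      q * ∑ a ∈ A, ‖b a‖ ^ 2 := by
  have hexp : ∀ a a' l : ℕ, fourier (-(l : ℤ)) (((a : ℝ) / q : ℝ) : UnitAddCircle) *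
      (starRingEnd ℂ) (fourier (-(l : ℤ)) (((a' : ℝ) / q : ℝ) : UnitAddCircle)) =
      fourier ((a' : ℤ) - a) (((l : ℝ) / q : ℝ) : UnitAddCircle) := by
    intro a a' l
    rw [← fourier_neg, neg_neg, fourier_coe_apply, fourier_coe_apply, fourier_coe_apply,
      ← Complex.exp_add]
    congr 1
    push_cast
    ring
  have hC : ((∑ l ∈ Finset.range q,
      ‖∑ a ∈ A, fourier (-(l : ℤ)) (((a : ℝ) / q : ℝ) : UnitAddCircle) * b a‖ ^ 2 : ℝ) : ℂ) =
      ((q * ∑ a ∈ A, ‖b a‖ ^ 2 : ℝ) : ℂ) := by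
    push_cast
    calc ∑ l ∈ Finset.range q,
          (‖∑ a ∈ A, fourier (-(l : ℤ)) (((a : ℝ) / q : ℝ) : UnitAddCircle) * b a‖ : ℂ) ^ 2
        = ∑ l ∈ Finset.range q, ∑ a ∈ A, ∑ a' ∈ A, b a * (starRingEnd ℂ) (b a') *
            fourier ((a' : ℤ) - a) (((l : ℝ) / q : ℝ) : UnitAddCircle) := by
          refine Finset.sum_congr rfl fun l _ => ?_
          rw [← Complex.mul_conj', map_sum, Finset.sum_mul_sum]
          refine Finset.sum_congr rfl fun a _ => Finset.sum_congr rfl fun a' _ => ?_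
          rw [← hexp, map_mul]
          ring
      _ = ∑ a ∈ A, ∑ a' ∈ A, b a * (starRingEnd ℂ) (b a') * (if a = a' then (q : ℂ) else 0) := by
          rw [Finset.sum_comm]
          refine Finset.sum_congr rfl fun a ha => ?_
          rw [Finset.sum_comm]
          refine Finset.sum_congr rfl fun a' ha' => ?_
          rw [← Finset.mul_sum, sum_range_fourier_div hq]
          congr 1
          have h1 := Finset.mem_Icc.1 (hA ha)
          have h2 := Finset.mem_Icc.1 (hA ha')
          refine if_congr ⟨fun h => ?_, fun h => by rw [h]; simp⟩ rfl rfl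
          have := Int.eq_zero_of_abs_lt_dvd h (by rw [abs_lt]; constructor <;> omega)
          omega
      _ = q * ∑ a ∈ A, (‖b a‖ : ℂ) ^ 2 := by
          rw [Finset.mul_sum]
          refine Finset.sum_congr rfl fun a ha => ?_
          simp only [mul_ite, mul_zero, Finset.sum_ite_eq, if_pos ha]
          rw [Complex.mul_conj', mul_comm]
  exact_mod_cast hC

/-! ### The arc pieces: bounds at the exponents 1, 2 and ∞ -/

/-- The function on `ℝ` with Fourier transform `χ` times the Fourier series of `twist q l f`. -/
noncomputable def arcPiece (χ : ℝ → ℂ) (q : ℕ) (l : ℤ) (f : ℤ → ℂ) : ℝ → ℂ :=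
  𝓕 (fun ξ : ℝ => χ ξ * seqFourier (twist q l f) (ξ : UnitAddCircle))

theorem continuous_seqFourier_coe {f : ℤ → ℂ} (hf : Summable fun n => ‖f n‖) :
    Continuous (fun ξ : ℝ => seqFourier f (ξ : UnitAddCircle)) :=
  (continuous_seqFourier hf).comp (AddCircle.continuous_mk' 1)

theorem integrable_mul_seqFourier {χ : ℝ → ℂ} (hχ : Integrable χ)
    {f : ℤ → ℂ} (hf : Summable fun n => ‖f n‖) :
    Integrable (fun ξ : ℝ => χ ξ * seqFourier f (ξ : UnitAddCircle)) :=
  hχ.mul_bdd (c := ∑' n, ‖f n‖) (continuous_seqFourier_coe hf).aestronglyMeasurable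
    (Filter.Eventually.of_forall fun _ => norm_seqFourier_le hf _)

theorem memLp_two_mul_seqFourier {χ : ℝ → ℂ} (hχ : MemLp χ 2)
    {f : ℤ → ℂ} (hf : Summable fun n => ‖f n‖) :
    MemLp (fun ξ : ℝ => χ ξ * seqFourier f (ξ : UnitAddCircle)) 2 :=
  MemLp.mul' (p := 2) (q := ∞) (memLp_top_of_bound
    (continuous_seqFourier_coe hf).aestronglyMeasurable (∑' n, ‖f n‖)
    (Filter.Eventually.of_forall fun _ => norm_seqFourier_le hf _)) hχ

theorem continuous_fourier_of_integrable {m : ℝ → ℂ} (hm : Integrable m) : Continuous (𝓕 m) :=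
  VectorFourier.fourierIntegral_continuous Real.continuous_fourierChar
    (by exact continuous_inner) hm

theorem continuous_arcPiece {χ : ℝ → ℂ} (hχ : Integrable χ) (q : ℕ) (l : ℤ)
    {f : ℤ → ℂ} (hf : Summable fun n => ‖f n‖) : Continuous (arcPiece χ q l f) :=
  continuous_fourier_of_integrable (integrable_mul_seqFourier hχ (summable_twist q l hf))

theorem arcPiece_add {χ : ℝ → ℂ} (hχ : Integrable χ) (q : ℕ) (l : ℤ) {f g : ℤ → ℂ}
    (hf : Summable fun n => ‖f n‖) (hg : Summable fun n => ‖g n‖) :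
    arcPiece χ q l (f + g) = arcPiece χ q l f + arcPiece χ q l g := by
  have h1 := integrable_mul_seqFourier hχ (summable_twist q l hf)
  have h2 := integrable_mul_seqFourier hχ (summable_twist q l hg)
  have h : (fun ξ : ℝ => χ ξ * seqFourier (twist q l (f + g)) (ξ : UnitAddCircle)) =
      (fun ξ : ℝ => χ ξ * seqFourier (twist q l f) (ξ : UnitAddCircle)) +
      (fun ξ : ℝ => χ ξ * seqFourier (twist q l g) (ξ : UnitAddCircle)) := by
    ext ξ
    simp only [Pi.add_apply]
    rw [twist_add, seqFourier_add (summable_twist q l hf) (summable_twist q l hg), mul_add]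
  rw [arcPiece, h]
  exact (VectorFourier.fourierIntegral_add Real.continuous_fourierChar
    (by exact continuous_inner) h1 h2)

/-- Termwise integration gives the exact identity: the arc piece is the sum of the twisted entries
times the integer translates of 𝓕 χ. -/
theorem enorm_arcPiece_le {χ : ℝ → ℂ} (hχ : Integrable χ) (q : ℕ) (l : ℤ) {f : ℤ → ℂ}
    (hf : Summable fun n => ‖f n‖) (y : ℝ) :
    ‖arcPiece χ q l f y‖ₑ ≤ ∑' n : ℤ, ‖twist q l f n‖ₑ * ‖𝓕 χ (y - n)‖ₑ := by
  have hg := summable_twist q l hf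
  set g := twist q l f
  have h1 : ∀ n : ℤ, Integrable (fun ξ : ℝ => 𝐞 (-(ξ * y)) • (χ ξ * (g n *
      fourier n (ξ : UnitAddCircle)))) := by
    intro n
    have hi : Integrable (fun ξ : ℝ => χ ξ * (g n * fourier n (ξ : UnitAddCircle))) := by
      refine hχ.mul_bdd (c := ‖g n‖) (Continuous.aestronglyMeasurable ?_)
        (Filter.Eventually.of_forall fun ξ => ?_)
      · exact continuous_const.mul ((fourier n).continuous.comp (AddCircle.continuous_mk' 1))
      · rw [norm_mul, norm_fourier_apply, mul_one]
    exact hi.bdd_mul (f := fun ξ : ℝ => (𝐞 (-(ξ * y)) : ℂ)) (c := 1)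
      (continuous_subtype_val.comp (Real.continuous_fourierChar.comp (by fun_prop))).aestronglyMeasurable
      (Filter.Eventually.of_forall fun v => (Circle.norm_coe _).le)
  have h2 : ∀ n : ℤ, ∫ ξ : ℝ, 𝐞 (-(ξ * y)) • (χ ξ * (g n * fourier n (ξ : UnitAddCircle))) =
      g n * 𝓕 χ (y - n) := by
    intro n
    rw [Real.fourier_real_eq, ← integral_const_mul]
    refine integral_congr_ae (Filter.Eventually.of_forall fun ξ => ?_)
    simp only [Circle.smul_def, smul_eq_mul, Real.fourierChar_apply, fourier_coe_apply]
    rw [show ((2 * Real.pi * -(ξ * (y - n)) : ℝ) : ℂ) * Complex.I =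
      ((2 * Real.pi * -(ξ * y) : ℝ) : ℂ) * Complex.I + 2 * Real.pi * Complex.I * n * ξ / (1 : ℝ) by
        push_cast; ring, Complex.exp_add]
    ring
  have h3 := integral_tsum_of_summable_integral_norm h1 (by
    have : ∀ n : ℤ, ∫ ξ : ℝ, ‖𝐞 (-(ξ * y)) • (χ ξ * (g n * fourier n (ξ : UnitAddCircle)))‖ =
        ‖g n‖ * ∫ ξ, ‖χ ξ‖ := by
      intro n
      rw [← integral_const_mul]
      refine integral_congr_ae (Filter.Eventually.of_forall fun ξ => ?_)
      simp only [Circle.norm_smul, norm_mul, norm_fourier_apply, mul_one, mul_comm]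
    simp only [this]
    exact hg.mul_right _)
  have h4 : arcPiece χ q l f y = ∑' n : ℤ, g n * 𝓕 χ (y - n) := by
    simp only [h2] at h3
    rw [h3, arcPiece, Real.fourier_real_eq]
    refine integral_congr_ae (Filter.Eventually.of_forall fun ξ => ?_)
    simp only [Circle.smul_def, smul_eq_mul, seqFourier]
    rw [tsum_mul_left, tsum_mul_left]
  rw [h4]
  refine (enorm_tsum_le_tsum_enorm).trans (le_of_eq ?_)
  simp only [enorm_mul]

theorem sum_range_enorm_ramanujanSum_le {q : ℕ} (hq : 0 < q) (z : ℤ) :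
    ∑ j ∈ Finset.range q, ‖ramanujanSum q (j + z)‖ₑ ≤ ENNReal.ofReal (q * q.divisors.card) := by
  refine le_trans (le_of_eq ?_) (ENNReal.ofReal_le_ofReal (sum_norm_ramanujanSum_le hq z))
  rw [ENNReal.ofReal_sum_of_nonneg (fun _ _ => norm_nonneg _)]
  simp only [ofReal_norm]

theorem tsum_int_eq_sum_range {q : ℕ} (hq : 0 < q) (F : ℤ → ℝ≥0∞) :
    ∑' n, F n = ∑ j ∈ Finset.range q, ∑' k : ℤ, F (k * q + j) := by
  have : NeZero q := ⟨hq.ne'⟩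
  rw [← (Int.divModEquiv q).symm.tsum_eq F]
  simp only [Int.divModEquiv_symm_apply]
  rw [ENNReal.tsum_prod (f := fun (k : ℤ) (j : Fin q) => F (k * q + (j : ℕ))), ENNReal.tsum_comm,
    tsum_fintype, Finset.sum_range]

/-- On each class of n modulo q the Ramanujan factor is constant and the kernel sums to O(1/q); the
sum of |c_q| over the classes returns q d(q). -/
theorem enorm_arcPiece_le_of_bounded {χ : ℝ → ℂ} (hχ : Integrable χ) {C S : ℝ} (hC : 0 ≤ C)
    (hK : IsAdaptedKernel C S (𝓕 χ)) {q : ℕ} (hq : 0 < q) (hS : q ≤ S) (l : ℤ) {f : ℤ → ℂ}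
    (hf : Summable fun n => ‖f n‖) {M : ℝ} (hM : ∀ n, ‖f n‖ ≤ M) (y : ℝ) :
    ‖arcPiece χ q l f y‖ ≤ 3 * C * Real.pi * q.divisors.card * M := by
  have hq' : (0 : ℝ) < q := by exact_mod_cast hq
  have hM0 : 0 ≤ M := (norm_nonneg _).trans (hM 0)
  have h : ‖arcPiece χ q l f y‖ₑ ≤ ENNReal.ofReal (3 * C * Real.pi * q.divisors.card * M) := by
    calc ‖arcPiece χ q l f y‖ₑ ≤ ∑' n : ℤ, ‖twist q l f n‖ₑ * ‖𝓕 χ (y - n)‖ₑ :=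
          enorm_arcPiece_le hχ q l hf y
      _ ≤ ∑' n : ℤ, (ENNReal.ofReal M * ‖ramanujanSum q (n - l)‖ₑ) * ‖𝓕 χ (y - n)‖ₑ := by
          gcongr with n
          rw [twist, enorm_mul, mul_comm]
          gcongr
          rw [← ofReal_norm]
          exact ENNReal.ofReal_le_ofReal (hM n)
      _ = ∑ j ∈ Finset.range q, ENNReal.ofReal M * ‖ramanujanSum q (j + (-l))‖ₑ *
            ∑' k : ℤ, ‖𝓕 χ ((y - j) + q * k)‖ₑ := by
          rw [tsum_int_eq_sum_range hq]
          refine Finset.sum_congr rfl fun j _ => ?_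
          rw [← (Equiv.neg ℤ).tsum_eq (fun k : ℤ => ‖𝓕 χ ((y - j) + q * k)‖ₑ),
            ← ENNReal.tsum_mul_left]
          refine tsum_congr fun k => ?_
          rw [show (k * q + j - l : ℤ) = (j + -l) + k * q by ring, ramanujanSum_add_mul hq]
          congr 4
          simp only [Equiv.neg_apply]
          push_cast
          ring_nf
      _ ≤ ∑ j ∈ Finset.range q, ENNReal.ofReal M * ‖ramanujanSum q (j + (-l))‖ₑ *
            ENNReal.ofReal (3 * C * Real.pi / q) := by
          gcongr with j
          exact hK.tsum_le hC hq hS _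
      _ = ENNReal.ofReal M * (∑ j ∈ Finset.range q, ‖ramanujanSum q (j + (-l))‖ₑ) *
            ENNReal.ofReal (3 * C * Real.pi / q) := by
          rw [← Finset.sum_mul, ← Finset.mul_sum]
      _ ≤ ENNReal.ofReal M * ENNReal.ofReal (q * q.divisors.card) *
            ENNReal.ofReal (3 * C * Real.pi / q) := by
          gcongr
          exact sum_range_enorm_ramanujanSum_le hq _
      _ = _ := by
          rw [← ENNReal.ofReal_mul hM0, ← ENNReal.ofReal_mul (by positivity)]
          congr 1
          field_simp
  rw [← ofReal_norm] at h
  exact (ENNReal.ofReal_le_ofReal_iff (by positivity)).1 h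

/-- Here the period average of |c_q(n - l)| is taken in l with n fixed, which is why the bound is
for the sum over l. -/
theorem sum_lintegral_enorm_arcPiece_le {χ : ℝ → ℂ} (hχ : Integrable χ) {C S : ℝ} (hC : 0 ≤ C)
    (hS : 0 < S) (hK : IsAdaptedKernel C S (𝓕 χ)) {q : ℕ} (hq : 0 < q) {f : ℤ → ℂ}
    (hf : Summable fun n => ‖f n‖) :
    ∑ l ∈ Finset.range q, ∫⁻ y, ‖arcPiece χ q l f y‖ₑ ≤
      ENNReal.ofReal (q * (q.divisors.card * (C * Real.pi))) * ∑' n, ‖f n‖ₑ := by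
  have hkm : Measurable (fun y : ℝ => ‖𝓕 χ y‖ₑ) :=
    (continuous_fourier_of_integrable hχ).measurable.enorm
  calc ∑ l ∈ Finset.range q, ∫⁻ y, ‖arcPiece χ q l f y‖ₑ
      ≤ ∑ l ∈ Finset.range q, ∫⁻ y, ∑' n : ℤ, ‖twist q l f n‖ₑ * ‖𝓕 χ (y - n)‖ₑ := by
        gcongr with l _ y
        exact enorm_arcPiece_le hχ q l hf y
    _ = ∑ l ∈ Finset.range q, ∑' n : ℤ, ‖twist q l f n‖ₑ * ∫⁻ y, ‖𝓕 χ y‖ₑ := by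
        refine Finset.sum_congr rfl fun l _ => ?_
        have hmn : ∀ n : ℤ, Measurable (fun y : ℝ => ‖𝓕 χ (y - n)‖ₑ) := fun n =>
          hkm.comp (by fun_prop)
        rw [lintegral_tsum fun n => ((hmn n).const_mul _).aemeasurable]
        refine tsum_congr fun n => ?_
        rw [lintegral_const_mul _ (hmn n), lintegral_sub_right_eq_self (fun y => ‖𝓕 χ y‖ₑ)]
    _ = (∑' n : ℤ, (∑ l ∈ Finset.range q, ‖ramanujanSum q (l + (-n))‖ₑ) * ‖f n‖ₑ) *
          ∫⁻ y, ‖𝓕 χ y‖ₑ := by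
        simp only [ENNReal.tsum_mul_right, ← Finset.sum_mul]
        congr 1
        rw [← Summable.tsum_finsetSum (fun _ _ => ENNReal.summable)]
        refine tsum_congr fun n => ?_
        rw [Finset.sum_mul]
        refine Finset.sum_congr rfl fun l _ => ?_
        rw [twist, enorm_mul, show (n - l : ℤ) = -(l + -n) by ring, ← ofReal_norm,
          norm_ramanujanSum_neg, ofReal_norm]
    _ ≤ (∑' n : ℤ, ENNReal.ofReal (q * q.divisors.card) * ‖f n‖ₑ) *
          ENNReal.ofReal (C * Real.pi) := by
        gcongr with n
        · exact sum_range_enorm_ramanujanSum_le hq _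
        · exact hK.lintegral_le hC hS
    _ = _ := by
        rw [ENNReal.tsum_mul_left, mul_right_comm, ← ENNReal.ofReal_mul (by positivity)]
        congr 2
        ring

theorem sum_enorm_sq_seqFourier_twist {q : ℕ} (hq : 0 < q) {f : ℤ → ℂ}
    (hf : Summable fun n => ‖f n‖) (ξ : UnitAddCircle) :
    ∑ l ∈ Finset.range q, ‖seqFourier (twist q l f) ξ‖ₑ ^ 2 =
      ENNReal.ofReal q * ∑ a ∈ (Finset.Icc 1 q).filter (fun a => a.Coprime q),
        ‖seqFourier f (ξ + (((a : ℝ) / q : ℝ) : UnitAddCircle))‖ₑ ^ 2 := by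
  have h5 : ∀ z : ℂ, ‖z‖ₑ ^ 2 = ENNReal.ofReal (‖z‖ ^ 2) := fun z => by
    rw [ENNReal.ofReal_pow (norm_nonneg _), ofReal_norm]
  simp only [h5]
  rw [← ENNReal.ofReal_sum_of_nonneg (fun _ _ => by positivity),
    ← ENNReal.ofReal_sum_of_nonneg (fun _ _ => by positivity), ← ENNReal.ofReal_mul (by positivity)]
  congr 1
  simp only [seqFourier_twist hf]
  exact sum_range_norm_sq_fourier_div hq (Finset.filter_subset _ _) _

/-- Plancherel on ℝ, then Parseval in l, which decouples the arcs; a translation puts each one back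
at a/q. -/
theorem sum_lintegral_enorm_sq_arcPiece_le {χ : ℝ → ℂ} (hχ : Integrable χ) (hχ2 : MemLp χ 2)
    (hχ1 : ∀ ξ, ‖χ ξ‖ ≤ 1) {κ : ℝ} (hsupp : ∀ ξ, κ ≤ |ξ| → χ ξ = 0) {q : ℕ} (hq : 0 < q)
    {f : ℤ → ℂ} (hf : Summable fun n => ‖f n‖) :
    ∑ l ∈ Finset.range q, ∫⁻ y, ‖arcPiece χ q l f y‖ₑ ^ 2 ≤
      ENNReal.ofReal q * ∑ a ∈ (Finset.Icc 1 q).filter (fun a => a.Coprime q),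
        ∫⁻ ξ in Set.Ioo ((a : ℝ) / q - κ) ((a : ℝ) / q + κ),
          ‖seqFourier f (ξ : UnitAddCircle)‖ₑ ^ 2 := by
  have hF : ∀ l : ℕ, Continuous (fun ξ : ℝ => seqFourier (twist q l f) (ξ : UnitAddCircle)) :=
    fun l => continuous_seqFourier_coe (summable_twist q l hf)
  have hFa : ∀ a : ℕ, Measurable (fun ξ : ℝ =>
      ‖seqFourier f ((ξ : UnitAddCircle) + (((a : ℝ) / q : ℝ) : UnitAddCircle))‖ₑ ^ 2) := by
    intro a
    have h := ((continuous_seqFourier_coe hf).comp (continuous_add_const ((a : ℝ) / q)))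
    exact (h.enorm.measurable.pow_const 2)
  calc ∑ l ∈ Finset.range q, ∫⁻ y, ‖arcPiece χ q l f y‖ₑ ^ 2
      = ∑ l ∈ Finset.range q, ∫⁻ ξ, ‖χ ξ * seqFourier (twist q l f) (ξ : UnitAddCircle)‖ₑ ^ 2 := by
        refine Finset.sum_congr rfl fun l _ => ?_
        exact lintegral_enorm_fourier_sq (integrable_mul_seqFourier hχ (summable_twist q l hf))
          (memLp_two_mul_seqFourier hχ2 (summable_twist q l hf))
    _ ≤ ∑ l ∈ Finset.range q, ∫⁻ ξ in Set.Ioo (-κ) κ,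
          ‖seqFourier (twist q l f) (ξ : UnitAddCircle)‖ₑ ^ 2 := by
        refine Finset.sum_le_sum fun l _ => ?_
        rw [← lintegral_indicator measurableSet_Ioo]
        refine lintegral_mono fun ξ => ?_
        by_cases hξ : ξ ∈ Set.Ioo (-κ) κ
        · rw [Set.indicator_of_mem hξ, enorm_mul]
          gcongr
          refine mul_le_of_le_one_left zero_le ?_
          rw [← ofReal_norm]
          exact ENNReal.ofReal_le_one.2 (hχ1 ξ)
        · rw [hsupp ξ (by by_contra! h; exact hξ (abs_lt.1 h))]
          simp
    _ = ∫⁻ ξ in Set.Ioo (-κ) κ, ∑ l ∈ Finset.range q,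
          ‖seqFourier (twist q l f) (ξ : UnitAddCircle)‖ₑ ^ 2 :=
        (lintegral_finsetSum _ fun l _ => ((hF l).enorm.measurable.pow_const 2)).symm
    _ = ∫⁻ ξ in Set.Ioo (-κ) κ,
          ENNReal.ofReal q * ∑ a ∈ (Finset.Icc 1 q).filter (fun a => a.Coprime q),
          ‖seqFourier f ((ξ : UnitAddCircle) + (((a : ℝ) / q : ℝ) : UnitAddCircle))‖ₑ ^ 2 := by
        simp only [sum_enorm_sq_seqFourier_twist hq hf]
    _ = ENNReal.ofReal q * ∑ a ∈ (Finset.Icc 1 q).filter (fun a => a.Coprime q),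
          ∫⁻ ξ in Set.Ioo (-κ) κ,
          ‖seqFourier f ((ξ : UnitAddCircle) + (((a : ℝ) / q : ℝ) : UnitAddCircle))‖ₑ ^ 2 := by
        rw [lintegral_const_mul _ (Finset.measurable_fun_sum _ fun a _ => hFa a),
          lintegral_finsetSum _ fun a _ => hFa a]
    _ = _ := by
        congr 1
        refine Finset.sum_congr rfl fun a _ => ?_
        have h := (measurePreserving_add_right volume ((a : ℝ) / q)).setLIntegral_comp_preimage
          (s := Set.Ioo ((a : ℝ) / q - κ) ((a : ℝ) / q + κ)) measurableSet_Ioo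
          (f := fun ξ : ℝ => ‖seqFourier f (ξ : UnitAddCircle)‖ₑ ^ 2)
          ((continuous_seqFourier_coe hf).enorm.measurable.pow_const 2)
        rw [← h, Set.preimage_add_const_Ioo]
        simp only [AddCircle.coe_add]
        congr 3 <;> ring

/-- Distinct reduced fractions differ by at least 1/(q q') ≥ 2κ, so the arcs are disjoint; they fit
in one period, where Parseval for f bounds the total. -/
theorem sum_sum_lintegral_enorm_sq_arcPiece_le {χ : ℝ → ℂ} (hχ : Integrable χ) (hχ2 : MemLp χ 2)
    (hχ1 : ∀ ξ, ‖χ ξ‖ ≤ 1) {κ : ℝ} (hsupp : ∀ ξ, κ ≤ |ξ| → χ ξ = 0)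
    {Q : Finset ℕ} (hQ : ∀ q ∈ Q, 0 < q) (hκ : 0 < κ)
    (hsep : ∀ q ∈ Q, ∀ q' ∈ Q, 2 * κ * (q * q') ≤ 1) {f : ℤ → ℂ} (hf : Summable fun n => ‖f n‖) :
    ∑ q ∈ Q, ENNReal.ofReal (1 / q) * ∑ l ∈ Finset.range q, ∫⁻ y, ‖arcPiece χ q l f y‖ₑ ^ 2 ≤
      ∑' n, ‖f n‖ₑ ^ 2 := by
  set P : Finset (Σ _ : ℕ, ℕ) :=
    Q.sigma (fun q => (Finset.Icc 1 q).filter (fun a => a.Coprime q)) with hP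
  set I : (Σ _ : ℕ, ℕ) → Set ℝ := fun p =>
    Set.Ioo ((p.2 : ℝ) / p.1 - κ) ((p.2 : ℝ) / p.1 + κ) with hI
  have hdisj : Set.PairwiseDisjoint (↑P) I := by
    rintro ⟨q, a⟩ hp ⟨q', a'⟩ hp' hne
    simp only [hP, Finset.coe_sigma, Set.mem_sigma_iff, Finset.mem_coe, Finset.mem_filter,
      Finset.mem_Icc] at hp hp'
    obtain ⟨hq, ⟨ha1, haq⟩, hc⟩ := hp
    obtain ⟨hq', ⟨ha1', haq'⟩, hc'⟩ := hp'
    have hq0 : (0 : ℝ) < q := by exact_mod_cast hQ q hq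
    have hq0' : (0 : ℝ) < q' := by exact_mod_cast hQ q' hq'
    rw [Function.onFun, Set.disjoint_left]
    intro x hx hx'
    simp only [hI, Set.mem_Ioo] at hx hx'
    have h1 : |(a : ℝ) / q - a' / q'| < 2 * κ := by
      rw [abs_lt]; constructor <;> linarith [hx.1, hx.2, hx'.1, hx'.2]
    have h2 : |((a * q' - a' * q : ℤ) : ℝ)| < 1 := by
      have e : ((a * q' - a' * q : ℤ) : ℝ) = ((a : ℝ) / q - a' / q') * (q * q') := by
        push_cast
        field_simp
      rw [e, abs_mul, abs_of_pos (mul_pos hq0 hq0')]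
      exact lt_of_lt_of_le (mul_lt_mul_of_pos_right h1 (mul_pos hq0 hq0')) (hsep q hq q' hq')
    have h3 : (a * q' - a' * q : ℤ) = 0 := by
      rw [← Int.abs_lt_one_iff]
      exact_mod_cast h2
    have h4 : a * q' = a' * q := by exact_mod_cast sub_eq_zero.1 h3
    have h5 : q ∣ q' := hc.symm.dvd_of_dvd_mul_left (Dvd.intro_left a' h4.symm)
    have h6 : q' ∣ q := hc'.symm.dvd_of_dvd_mul_left (Dvd.intro_left a h4)
    obtain rfl : q = q' := Nat.dvd_antisymm h5 h6
    obtain rfl : a = a' := Nat.eq_of_mul_eq_mul_right (hQ q hq) h4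
    exact hne rfl
  -- The representatives satisfy 2κ ≤ 1/q ≤ a/q ≤ 1, so the period starting at κ contains every arc
  -- unbroken.
  have hsub : (⋃ p ∈ P, I p) ⊆ Set.Ioc κ (κ + 1) := by
    refine Set.iUnion₂_subset ?_
    rintro ⟨q, a⟩ hp x hx
    simp only [hP, Finset.mem_sigma, Finset.mem_filter, Finset.mem_Icc] at hp
    obtain ⟨hq, ⟨ha1, haq⟩, -⟩ := hp
    have hq0 : (0 : ℝ) < q := by exact_mod_cast hQ q hq
    have hq1 : (1 : ℝ) ≤ q := by exact_mod_cast hQ q hq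
    have ha1' : (1 : ℝ) ≤ a := by exact_mod_cast ha1
    have haq' : (a : ℝ) ≤ q := by exact_mod_cast haq
    have h1 : (a : ℝ) / q ≤ 1 := (div_le_one hq0).2 haq'
    have h2 : 2 * κ ≤ (a : ℝ) / q := by
      rw [le_div_iff₀ hq0]
      have h3 := hsep q hq q hq
      have h4 : 2 * κ * q ≤ 2 * κ * (q * q) := by
        refine mul_le_mul_of_nonneg_left ?_ (by positivity)
        nlinarith
      linarith
    simp only [hI, Set.mem_Ioo] at hx
    exact ⟨by linarith [hx.1], by linarith [hx.2]⟩
  calc ∑ q ∈ Q, ENNReal.ofReal (1 / q) * ∑ l ∈ Finset.range q, ∫⁻ y, ‖arcPiece χ q l f y‖ₑ ^ 2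
      ≤ ∑ q ∈ Q, ∑ a ∈ (Finset.Icc 1 q).filter (fun a => a.Coprime q),
        ∫⁻ ξ in Set.Ioo ((a : ℝ) / q - κ) ((a : ℝ) / q + κ),
          ‖seqFourier f (ξ : UnitAddCircle)‖ₑ ^ 2 := by
        refine Finset.sum_le_sum fun q hq => ?_
        have hq0 : (0 : ℝ) < q := by exact_mod_cast hQ q hq
        refine (mul_le_mul_right (sum_lintegral_enorm_sq_arcPiece_le hχ hχ2 hχ1 hsupp
          (hQ q hq) hf) _).trans ?_
        rw [← mul_assoc, ← ENNReal.ofReal_mul (by positivity), one_div_mul_cancel hq0.ne',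
          ENNReal.ofReal_one, one_mul]
    _ = ∑ p ∈ P, ∫⁻ ξ in I p, ‖seqFourier f (ξ : UnitAddCircle)‖ₑ ^ 2 :=
        (Finset.sum_sigma' _ _ _)
    _ = ∫⁻ ξ in ⋃ p ∈ P, I p, ‖seqFourier f (ξ : UnitAddCircle)‖ₑ ^ 2 :=
        (lintegral_biUnion_finset hdisj (fun _ _ => measurableSet_Ioo) _).symm
    _ ≤ ∫⁻ ξ in Set.Ioc κ (κ + 1), ‖seqFourier f (ξ : UnitAddCircle)‖ₑ ^ 2 :=
        lintegral_mono_set hsub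
    _ = _ := lintegral_enorm_seqFourier_sq hf κ

/-! ### The arc pieces as one operator, interpolated -/

/-- The measure on triples `(q, l, y)` with `q ∈ Q` and `0 ≤ l < q` which is Lebesgue measure in
`y` and gives the pair `(q, l)` the weight `1 / q`. -/
noncomputable def arcMeasure (Q : Finset ℕ) : Measure (ℕ × ℕ × ℝ) :=
  ∑ q ∈ Q, ENNReal.ofReal (1 / q) • ∑ l ∈ Finset.range q,
    (volume : Measure ℝ).map (fun y => (q, l, y))

theorem lintegral_arcMeasure (Q : Finset ℕ) {F : ℕ × ℕ × ℝ → ℝ≥0∞} (hF : Measurable F) :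
    ∫⁻ x, F x ∂(arcMeasure Q) =
      ∑ q ∈ Q, ENNReal.ofReal (1 / q) * ∑ l ∈ Finset.range q, ∫⁻ y, F (q, l, y) := by
  rw [arcMeasure, lintegral_finsetSum_measure]
  refine Finset.sum_congr rfl fun q _ => ?_
  rw [lintegral_smul_measure, lintegral_finsetSum_measure, smul_eq_mul]
  congr 1
  refine Finset.sum_congr rfl fun l _ => ?_
  rw [lintegral_map hF (by fun_prop)]

theorem exists_sum_lintegral_rpow_arcPiece_le {s C : ℝ} (hs : 1 < s) (hC : 0 < C) :
    ∃ E : ℝ, 0 < E ∧ ∀ (χ : ℝ → ℂ) (S κ d P : ℝ) (Q : Finset ℕ), Integrable χ → MemLp χ 2 →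
      (∀ ξ, ‖χ ξ‖ ≤ 1) → (∀ ξ, κ ≤ |ξ| → χ ξ = 0) → IsAdaptedKernel C S (𝓕 χ) → 0 < κ → 1 ≤ d →
      1 ≤ P → (Q.card : ℝ) ≤ P → (∀ q ∈ Q, 0 < q ∧ (q : ℝ) ≤ S ∧ (q.divisors.card : ℝ) ≤ d) →
      (∀ q ∈ Q, ∀ q' ∈ Q, 2 * κ * (q * q') ≤ 1) → ∀ f : ℤ → ℂ, (Summable fun n => ‖f n‖) →
      ∑ q ∈ Q, ENNReal.ofReal (1 / q) *
          ∑ l ∈ Finset.range q, ∫⁻ y, ‖arcPiece χ q l f y‖ₑ ^ s ≤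
        ENNReal.ofReal (E * (d ^ s * P ^ max (2 - s) 0)) * ∑' n, ‖f n‖ₑ ^ s := by
  have hs0 : 0 < s := by linarith
  have hpi := Real.pi_pos
  -- One constant for the three ranges of s. Outside its range an interpolation constant may be
  -- meaningless or negative; the entry 1 keeps the maximum positive and serves s = 2.
  obtain ⟨E, hE, hE1, hE2, hE3⟩ : ∃ E : ℝ, 0 < E ∧
      (2 < s → s * (4 * ((2 * (3 * C * Real.pi)) ^ (s - 2) / (s - 2))) ≤ E) ∧ 1 ≤ E ∧
      (s < 2 → s * ((4 / (2 - s) + 2 / (s - 1)) * (C * Real.pi) ^ (2 - s)) ≤ E) :=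
    ⟨max (max (s * (4 * ((2 * (3 * C * Real.pi)) ^ (s - 2) / (s - 2)))) 1)
        (s * ((4 / (2 - s) + 2 / (s - 1)) * (C * Real.pi) ^ (2 - s))),
      by positivity, fun _ => by simp, by simp, fun _ => by simp⟩
  refine ⟨E, hE, fun χ S κ d P Q hχ hχ2 hχ1 hsupp hK hκ hd hP hcard hQ hsep f hf => ?_⟩
  -- Set to zero off `Q` so that the sup bound holds at every point, not merely almost everywhere.
  set T : (ℤ → ℂ) → ℕ × ℕ × ℝ → ℂ := fun f x =>
    if x.1 ∈ Q then arcPiece χ x.1 x.2.1 f x.2.2 else 0 with hT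
  have hmeas : ∀ f : ℤ → ℂ, (Summable fun n => ‖f n‖) → Measurable (T f) := by
    intro f hf
    refine measurable_from_prod_countable_right fun q => ?_
    refine measurable_from_prod_countable_right fun l => ?_
    by_cases hq : q ∈ Q
    · simp only [hT, if_pos hq]
      exact (continuous_arcPiece hχ q l hf).measurable
    · simp only [hT, if_neg hq]
      exact measurable_const
  have hadd : ∀ f g : ℤ → ℂ, (Summable fun n => ‖f n‖) → (Summable fun n => ‖g n‖) →
      T (f + g) = T f + T g := by
    intro f g hf hg
    ext x
    simp only [hT, Pi.add_apply, arcPiece_add hχ _ _ hf hg]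
    split_ifs <;> simp
  -- The free function `p` lets one statement serve the exponents 1, 2 and s.
  have hval : ∀ (p : ℝ → ℝ≥0∞ → ℝ≥0∞) (g : ℤ → ℂ), ∑ q ∈ Q, ENNReal.ofReal (1 / q) *
      ∑ l ∈ Finset.range q, ∫⁻ y, p s ‖T g (q, l, y)‖ₑ = ∑ q ∈ Q, ENNReal.ofReal (1 / q) *
      ∑ l ∈ Finset.range q, ∫⁻ y, p s ‖arcPiece χ q l g y‖ₑ := by
    intro p g
    refine Finset.sum_congr rfl fun q hq => ?_
    simp only [hT, if_pos hq]
  have htwo : ∀ f : ℤ → ℂ, (Summable fun n => ‖f n‖) →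
      ∫⁻ x, ‖T f x‖ₑ ^ 2 ∂(arcMeasure Q) ≤ ∑' n, ‖f n‖ₑ ^ 2 := by
    intro f hf
    rw [lintegral_arcMeasure Q ((hmeas f hf).enorm.pow_const 2), hval (fun _ z => z ^ 2)]
    exact sum_sum_lintegral_enorm_sq_arcPiece_le hχ hχ2 hχ1 hsupp (fun q hq => (hQ q hq).1) hκ hsep hf
  have hds : 1 ≤ d ^ s := Real.one_le_rpow hd hs0.le
  have hPs : 1 ≤ P ^ max (2 - s) 0 := Real.one_le_rpow hP (le_max_right _ _)
  rw [← hval (fun s z => z ^ s), ← lintegral_arcMeasure Q ((hmeas f hf).enorm.pow_const s)]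
  rcases lt_trichotomy s 2 with h2 | h2 | h2
  · have hone : ∀ f : ℤ → ℂ, (Summable fun n => ‖f n‖) →
        ∫⁻ x, ‖T f x‖ₑ ∂(arcMeasure Q) ≤ ENNReal.ofReal (C * Real.pi * d * P) * ∑' n, ‖f n‖ₑ := by
      intro f hf
      rw [lintegral_arcMeasure Q (hmeas f hf).enorm, hval (fun _ z => z)]
      calc _ ≤ ∑ q ∈ Q, ENNReal.ofReal (C * Real.pi * d) * ∑' n, ‖f n‖ₑ := by
            refine Finset.sum_le_sum fun q hq => ?_
            obtain ⟨hq0, hqS, hqd⟩ := hQ q hq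
            have hq0' : (0 : ℝ) < q := by exact_mod_cast hq0
            refine (mul_le_mul_right (sum_lintegral_enorm_arcPiece_le hχ hC.le
              (hq0'.trans_le hqS) hK hq0 hf) _).trans ?_
            rw [← mul_assoc, ← ENNReal.ofReal_mul (by positivity), ← mul_assoc,
              one_div_mul_cancel hq0'.ne', one_mul, mul_comm _ (C * Real.pi)]
            gcongr
        _ = ENNReal.ofReal (Q.card * (C * Real.pi * d)) * ∑' n, ‖f n‖ₑ := by
            rw [Finset.sum_const, nsmul_eq_mul, ← mul_assoc,
              ENNReal.ofReal_mul (p := (Q.card : ℝ)) (by positivity), ENNReal.ofReal_natCast]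
        _ ≤ _ := by
            refine mul_le_mul_left (ENNReal.ofReal_le_ofReal ?_) _
            rw [mul_comm]
            gcongr
    refine (lintegral_rpow_le_of_one_two (A := C * Real.pi * d * P) (by positivity) hs h2
      hmeas hadd hone htwo hf).trans ?_
    refine mul_le_mul_left (ENNReal.ofReal_le_ofReal ?_) _
    have h2' : 0 < 2 - s := by linarith
    have h1' : 0 < s - 1 := by linarith
    rw [max_eq_left h2'.le, mul_assoc (C * Real.pi), Real.mul_rpow (by positivity) (by positivity),
      Real.mul_rpow (x := d) (by positivity) (by positivity)]
    calc s * ((4 / (2 - s) + 2 / (s - 1)) * ((C * Real.pi) ^ (2 - s) * (d ^ (2 - s) * P ^ (2 - s))))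
        = s * ((4 / (2 - s) + 2 / (s - 1)) * (C * Real.pi) ^ (2 - s)) *
            (d ^ (2 - s) * P ^ (2 - s)) := by ring
      _ ≤ E * (d ^ s * P ^ (2 - s)) := by
          have := hE3 h2
          have h3 : d ^ (2 - s) ≤ d ^ s := Real.rpow_le_rpow_of_exponent_le hd (by linarith)
          gcongr
  · subst h2
    simp only [ENNReal.rpow_two]
    refine (htwo f hf).trans ?_
    have h3 : (1 : ℝ) ≤ E * (d ^ (2 : ℝ) * P ^ max (2 - 2 : ℝ) 0) :=
      one_le_mul_of_one_le_of_one_le hE2 (one_le_mul_of_one_le_of_one_le hds hPs)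
    exact le_mul_of_one_le_left zero_le (ENNReal.one_le_ofReal.2 h3)
  · have htop : ∀ f : ℤ → ℂ, (Summable fun n => ‖f n‖) → ∀ M, (∀ n, ‖f n‖ ≤ M) →
        ∀ x, ‖T f x‖ ≤ 3 * C * Real.pi * d * M := by
      intro f hf M hM x
      have hM0 : 0 ≤ M := (norm_nonneg _).trans (hM 0)
      simp only [hT]
      split_ifs with hq
      · obtain ⟨hq0, hqS, hqd⟩ := hQ _ hq
        refine (enorm_arcPiece_le_of_bounded hχ hC.le hK hq0 hqS _ hf hM _).trans ?_
        gcongr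
      · rw [norm_zero]; positivity
    refine (lintegral_rpow_le_of_two_top (A := 3 * C * Real.pi * d) (by positivity) h2
      hmeas hadd htop htwo hf).trans ?_
    refine mul_le_mul_left (ENNReal.ofReal_le_ofReal ?_) _
    have h2' : 0 < s - 2 := by linarith
    rw [← mul_assoc 2, Real.mul_rpow (by positivity) (by positivity)]
    calc s * (4 * ((2 * (3 * C * Real.pi)) ^ (s - 2) * d ^ (s - 2) / (s - 2)))
        = s * (4 * ((2 * (3 * C * Real.pi)) ^ (s - 2) / (s - 2))) * (d ^ (s - 2) * 1) := by ring
      _ ≤ E * (d ^ s * P ^ max (2 - s) 0) := by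
          have := hE1 h2
          have h3 : d ^ (s - 2) ≤ d ^ s := Real.rpow_le_rpow_of_exponent_le hd (by linarith)
          gcongr

/-! ### Using the hypothesis on the line -/

theorem eLpNorm_ofReal_rpow {X ε : Type*} [MeasurableSpace X] [TopologicalSpace ε] [ContinuousENorm ε]
    {μ : Measure X} (F : X → ε) {s : ℝ} (hs : 0 < s) :
    eLpNorm F (ENNReal.ofReal s) μ ^ s = ∫⁻ x, ‖F x‖ₑ ^ s ∂μ := by
  rw [eLpNorm_eq_lintegral_rpow_enorm_toReal (by simpa using hs) ENNReal.ofReal_ne_top,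
    ENNReal.toReal_ofReal hs.le, ← ENNReal.rpow_mul, one_div_mul_cancel hs.ne', ENNReal.rpow_one]

theorem exists_fourierInv_eq {g : ℝ → ℂ} (hg : Integrable g) (hg2 : MemLp g 2) :
    ∃ f : Lp ℂ 2 (volume : Measure ℝ), f =ᵐ[volume] 𝓕 g ∧
      (𝓕⁻ f : Lp ℂ 2 (volume : Measure ℝ)) =ᵐ[volume] g := by
  refine ⟨𝓕 (hg2.toLp g), fourier_toLp_ae_eq hg hg2, ?_⟩
  rw [FourierTransform.fourierInv_fourier_eq]
  exact hg2.coeFn_toLp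

/-- The hypothesis is all that is known about Φ_N. Testing it on the Schwartz function 𝓕 g shows
that Φ_N is measurable and square integrable against g. -/
theorem HasVariationBound.memLp_two {Φ : ℕ → ℝ → ℂ} {r s B : ℝ} (h : HasVariationBound Φ r s B)
    {g : ℝ → ℂ} (hg : ContDiff ℝ ∞ g) (hc : HasCompactSupport g) (N : ℕ) :
    MemLp (fun ξ => Φ N ξ * g ξ) 2 := by
  obtain ⟨f, hf1, hf2⟩ := exists_fourierInv_eq (hg.continuous.integrable_of_hasCompactSupport hc)
    (hg.continuous.memLp_of_hasCompactSupport hc)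
  have hk : 𝓕 g = 𝓕 (hc.toSchwartzMap hg) := by rw [SchwartzMap.fourier_coe]; rfl
  have hf : MemLp f (ENNReal.ofReal s) volume := by
    rw [memLp_congr_ae hf1, hk]
    exact (𝓕 (hc.toSchwartzMap hg)).memLp _ _
  obtain ⟨h1, -⟩ := h f hf
  refine (memLp_congr_ae ?_).1 (h1 N)
  filter_upwards [hf2] with ξ hξ
  rw [hξ]

/-- The hypothesis for f = 𝓕 g, with the L² transforms replaced by the continuous integral ones,
which can later be evaluated at integers. If f is not in L^s the right side is infinite. -/
theorem HasVariationBound.lintegral_le {Φ : ℕ → ℝ → ℂ} {r s B : ℝ} (h : HasVariationBound Φ r s B)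
    (hs : 0 < s) (hB : 0 < B) {g : ℝ → ℂ} (hg : Integrable g) (hg2 : MemLp g 2)
    (hΦ : ∀ N, Integrable (fun ξ => Φ N ξ * g ξ)) :
    ∫⁻ y, variationNorm r (fun N => 𝓕 (fun ξ => Φ N ξ * g ξ) y) ^ s ≤
      ENNReal.ofReal (B ^ s) * ∫⁻ y, ‖𝓕 g y‖ₑ ^ s := by
  by_cases htop : ∫⁻ y, ‖𝓕 g y‖ₑ ^ s = ⊤
  · rw [htop, ENNReal.mul_top (by simpa using Real.rpow_pos_of_pos hB s)]
    exact le_top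
  obtain ⟨f, hf1, hf2⟩ := exists_fourierInv_eq hg hg2
  have hf : MemLp f (ENNReal.ofReal s) volume := by
    rw [memLp_congr_ae hf1]
    refine ⟨(continuous_fourier_of_integrable hg).aestronglyMeasurable, ?_⟩
    rw [lt_top_iff_ne_top]
    intro h'
    rw [← eLpNorm_ofReal_rpow _ hs, h', ENNReal.top_rpow_of_pos hs] at htop
    exact htop rfl
  obtain ⟨h1, h2⟩ := h f hf
  have hae : ∀ N, (fun ξ => Φ N ξ * (𝓕⁻ f : Lp ℂ 2 (volume : Measure ℝ)) ξ) =ᵐ[volume]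
      fun ξ => Φ N ξ * g ξ := fun N => by
    filter_upwards [hf2] with ξ hξ
    rw [hξ]
  have hL2 : ∀ N, MemLp (fun ξ => Φ N ξ * g ξ) 2 := fun N => (memLp_congr_ae (hae N)).1 (h1 N)
  have hF : ∀ N, (𝓕 ((h1 N).toLp) : Lp ℂ 2 (volume : Measure ℝ)) =ᵐ[volume]
      𝓕 (fun ξ => Φ N ξ * g ξ) := by
    intro N
    rw [(MemLp.toLp_eq_toLp_iff (h1 N) (hL2 N)).2 (hae N)]
    exact fourier_toLp_ae_eq (hΦ N) (hL2 N)
  rw [eLpNorm_congr_ae hf1] at h2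
  have h3 := ENNReal.rpow_le_rpow h2 hs.le
  rw [ENNReal.mul_rpow_of_nonneg _ _ hs.le, eLpNorm_ofReal_rpow _ hs, eLpNorm_ofReal_rpow _ hs,
    ENNReal.ofReal_rpow_of_pos hB] at h3
  refine le_trans (le_of_eq ?_) h3
  refine lintegral_congr_ae ?_
  filter_upwards [ae_all_iff.2 hF] with y hy
  simp only [hy, enorm_eq_self]

/-! ### Fourier coefficients of the multiplier on the circle -/

theorem liftIco_coe_of_mem_Ioc {k : ℝ → ℂ} (hk : ∀ x, 1 / 2 ≤ |x| → k x = 0) {ξ : ℝ}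
    (hξ : ξ ∈ Set.Ioc (-1 / 2 : ℝ) (-1 / 2 + 1)) :
    AddCircle.liftIco (1 : ℝ) (-1 / 2) k (ξ : UnitAddCircle) = k ξ := by
  have h0 : k (-1 / 2) = k (-1 / 2 + 1) := by rw [hk, hk] <;> norm_num [abs_of_neg, abs_of_pos]
  rw [← AddCircle.liftIoc_eq_liftIco h0, AddCircle.liftIoc_coe_apply hξ]

theorem haarAddCircle_eq_volume : AddCircle.haarAddCircle (T := 1) = volume := by
  rw [AddCircle.volume_eq_smul_haarAddCircle]; simp

theorem integrable_liftIco {k : ℝ → ℂ} (hk : ∀ x, 1 / 2 ≤ |x| → k x = 0) (hi : Integrable k) :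
    Integrable (AddCircle.liftIco (1 : ℝ) (-1 / 2) k) AddCircle.haarAddCircle := by
  have h0 : k (-1 / 2) = k (-1 / 2 + 1) := by rw [hk, hk] <;> norm_num [abs_of_neg, abs_of_pos]
  rw [← AddCircle.liftIoc_eq_liftIco h0, haarAddCircle_eq_volume, ← memLp_one_iff_integrable]
  exact MemLp.memLp_liftIoc (memLp_one_iff_integrable.2 hi.integrableOn)

/-- Translating by θ produces the phase; as k vanishes outside one period, the integral over the
circle is one over ℝ. -/
theorem fourierCoeff_liftIco_mul {k : ℝ → ℂ} (hk : ∀ x, 1 / 2 ≤ |x| → k x = 0)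
    (F : UnitAddCircle → ℂ) (θ : UnitAddCircle) (x : ℤ) :
    fourierCoeff (fun ξ => AddCircle.liftIco (1 : ℝ) (-1 / 2) k (ξ - θ) * F ξ) x =
      fourier (-x) θ * 𝓕 (fun ξ : ℝ => k ξ * F (ξ + θ)) x := by
  rw [fourierCoeff, haarAddCircle_eq_volume]
  rw [← integral_add_right_eq_self _ θ]
  simp only [add_sub_cancel_right, fourier_add_apply]
  rw [← UnitAddCircle.integral_preimage (-1 / 2), Real.fourier_real_eq, ← integral_const_mul]
  rw [← integral_indicator measurableSet_Ioc]
  refine integral_congr_ae (Filter.Eventually.of_forall fun ξ => ?_)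
  by_cases hξ : ξ ∈ Set.Ioc (-1 / 2 : ℝ) (-1 / 2 + 1)
  · simp only [Set.indicator_of_mem hξ, liftIco_coe_of_mem_Ioc hk hξ, smul_eq_mul, Circle.smul_def,
      Real.fourierChar_apply]
    rw [fourier_coe_apply]
    have : ((2 * Real.pi * -(ξ * (x : ℝ)) : ℝ) : ℂ) * Complex.I =
        2 * Real.pi * Complex.I * ((-x : ℤ) : ℂ) * ξ / (1 : ℝ) := by push_cast; ring
    rw [this]
    ring
  · simp only [Set.indicator_of_notMem hξ]
    have h1 : 1 / 2 ≤ |ξ| := by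
      by_contra! h
      rw [abs_lt] at h
      exact hξ ⟨by linarith [h.1], by linarith [h.2]⟩
    rw [hk ξ h1]
    simp

theorem integrable_arcMultiplier_mul {Φ : ℕ → ℝ → ℂ} {η : ℝ → ℝ} {D : ℝ} {t N : ℕ}
    (hk : ∀ x, 1 / 2 ≤ |x| → Φ N x * (cutoff η D t x : ℂ) = 0)
    (hi : Integrable fun x => Φ N x * (cutoff η D t x : ℂ)) {f : ℤ → ℂ}
    (hf : Summable fun n => ‖f n‖) :
    Integrable (fun ξ => arcMultiplier Φ η D t N ξ * seqFourier f ξ) AddCircle.haarAddCircle := by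
  refine Integrable.mul_bdd (c := ∑' n, ‖f n‖) ?_ (continuous_seqFourier hf).aestronglyMeasurable
    (Filter.Eventually.of_forall fun _ => norm_seqFourier_le hf _)
  refine integrable_finsetSum _ fun q _ => integrable_finsetSum _ fun a _ => Integrable.const_mul ?_ _
  exact (integrable_liftIco hk hi).comp_sub_right _

/-- The phases e(-xa/q) from the translations are exactly the coefficients in `seqFourier_twist`
with l = x, so the sum over a collapses to one twist. -/
theorem fourierCoeff_arcMultiplier_mul {Φ : ℕ → ℝ → ℂ} {η : ℝ → ℝ} {D : ℝ} {t N : ℕ}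
    (hk : ∀ x, 1 / 2 ≤ |x| → Φ N x * (cutoff η D t x : ℂ) = 0)
    (hi : Integrable fun x => Φ N x * (cutoff η D t x : ℂ)) {f : ℤ → ℂ}
    (hf : Summable fun n => ‖f n‖) (x : ℤ) :
    fourierCoeff (fun ξ => arcMultiplier Φ η D t N ξ * seqFourier f ξ) x =
      ∑ q ∈ Finset.Ico (2 ^ t) (2 ^ (t + 1)),
        (ArithmeticFunction.moebius q : ℂ) / (Nat.totient q : ℂ) *
        𝓕 (fun ξ : ℝ => Φ N ξ * ((cutoff η D t ξ : ℂ) *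
          seqFourier (twist q x f) (ξ : UnitAddCircle))) x := by
  set k : ℝ → ℂ := fun x => Φ N x * (cutoff η D t x : ℂ) with hkdef
  have hint : ∀ θ : UnitAddCircle, Integrable
      (fun ξ => AddCircle.liftIco (1 : ℝ) (-1 / 2) k (ξ - θ) * seqFourier f ξ)
      AddCircle.haarAddCircle := fun θ =>
    Integrable.mul_bdd (c := ∑' n, ‖f n‖) ((integrable_liftIco hk hi).comp_sub_right _)
      (continuous_seqFourier hf).aestronglyMeasurable
      (Filter.Eventually.of_forall fun _ => norm_seqFourier_le hf _)
  have e1 : (fun ξ => arcMultiplier Φ η D t N ξ * seqFourier f ξ) =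
      ∑ q ∈ Finset.Ico (2 ^ t) (2 ^ (t + 1)), ∑ a ∈ (Finset.Icc 1 q).filter (fun a => a.Coprime q),
        fun ξ => (ArithmeticFunction.moebius q : ℂ) / (Nat.totient q : ℂ) *
          (AddCircle.liftIco (1 : ℝ) (-1 / 2) k
            (ξ - (((a : ℝ) / (q : ℝ) : ℝ) : UnitAddCircle)) * seqFourier f ξ) := by
    ext ξ
    simp only [arcMultiplier, Finset.sum_apply, Finset.sum_mul, mul_assoc]
    rfl
  rw [e1, fourierCoeff.sum _ _ (fun q _ => integrable_finsetSum' _ fun a _ => (hint _).const_mul _)]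
  rw [Finset.sum_apply]
  refine Finset.sum_congr rfl fun q _ => ?_
  rw [fourierCoeff.sum _ _ (fun a _ => (hint _).const_mul _), Finset.sum_apply]
  simp only [fourierCoeff.const_mul, ← Finset.mul_sum]
  rw [Finset.sum_congr rfl fun a _ => fourierCoeff_liftIco_mul hk _ _ _]
  congr 1
  have hci : ∀ a : ℕ, Integrable (fun ξ : ℝ => 𝐞 (-(ξ * (x : ℝ))) • (k ξ *
      seqFourier f ((ξ : UnitAddCircle) + (((a : ℝ) / (q : ℝ) : ℝ) : UnitAddCircle)))) := by
    intro a
    have h1 : Integrable (fun ξ : ℝ => k ξ *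
        seqFourier f ((ξ : UnitAddCircle) + (((a : ℝ) / (q : ℝ) : ℝ) : UnitAddCircle))) := by
      refine hi.mul_bdd (c := ∑' n, ‖f n‖) (Continuous.aestronglyMeasurable ?_)
        (Filter.Eventually.of_forall fun _ => norm_seqFourier_le hf _)
      exact (continuous_seqFourier_coe hf).comp (continuous_add_const ((a : ℝ) / q))
    exact h1.bdd_mul (f := fun ξ : ℝ => (𝐞 (-(ξ * (x : ℝ))) : ℂ)) (c := 1)
      (continuous_subtype_val.comp (Real.continuous_fourierChar.comp (by fun_prop))).aestronglyMeasurable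
      (Filter.Eventually.of_forall fun v => (Circle.norm_coe _).le)
  simp only [Real.fourier_real_eq]
  simp only [← integral_const_mul]
  rw [← integral_finsetSum _ fun a _ => (hci a).const_mul _]
  refine integral_congr_ae (Filter.Eventually.of_forall fun ξ => ?_)
  simp only [seqFourier_twist hf, Circle.smul_def, smul_eq_mul, hkdef, Finset.mul_sum]
  refine Finset.sum_congr rfl fun a _ => ?_
  ring

/-! ### One denominator, then the sum over denominators -/

theorem twist_add_mul {q : ℕ} (hq : 0 < q) (l k : ℤ) (f : ℤ → ℂ) :
    twist q (k * q + l) f = twist q l f := by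
  ext n
  rw [twist, twist, show n - (k * q + l) = (n - l) + (-k) * q by ring, ramanujanSum_add_mul hq]

theorem norm_moebius_div_totient_le {q : ℕ} {d R : ℝ} (hR : 0 < R) (hRq : R ≤ q)
    (hd : (q.divisors.card : ℝ) ≤ d) :
    ‖(ArithmeticFunction.moebius q : ℂ) / (Nat.totient q : ℂ)‖ ≤ d / R := by
  have hq0 : (0 : ℝ) < q := hR.trans_le hRq
  have hφ : (0 : ℝ) < q.totient := by
    exact_mod_cast Nat.totient_pos.2 (by exact_mod_cast hq0)
  have hμ : ‖(ArithmeticFunction.moebius q : ℂ)‖ ≤ 1 := by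
    rw [Complex.norm_intCast]
    exact_mod_cast ArithmeticFunction.abs_moebius_le_one
  have h1 : (q : ℝ) ≤ q.totient * q.divisors.card := by
    exact_mod_cast le_totient_mul_card_divisors q
  rw [norm_div, Complex.norm_natCast, div_le_div_iff₀ hφ hR]
  calc _ ≤ 1 * R := by gcongr
    _ ≤ q := by linarith
    _ ≤ q.totient * q.divisors.card := h1
    _ ≤ d * q.totient := by rw [mul_comm]; gcongr

/-- On x ≡ l mod q the twist is frozen, so sampling applies with the wider cutoff χ', and then the
hypothesis with the multiplier χ times the twisted series. -/
theorem tsum_variationNorm_progression_le {Φ : ℕ → ℝ → ℂ} {r s B C S : ℝ} (hr : 1 ≤ r) (hs : 1 < s)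
    (hB : 0 < B) (hΦ : HasVariationBound Φ r s B) (hC : 0 ≤ C) {q : ℕ} (hq : 0 < q) (hS : q ≤ S)
    {χ χ' : ℝ → ℂ} (hχ : Integrable χ) (hχ2 : MemLp χ 2) (hΦχ : ∀ N, Integrable fun ξ => Φ N ξ * χ ξ)
    (hχ' : ContDiff ℝ ∞ χ') (hc' : HasCompactSupport χ') (hχχ' : ∀ ξ, χ ξ * χ' ξ = χ ξ)
    (hK : IsAdaptedKernel C S (𝓕 χ')) {f : ℤ → ℂ} (hf : Summable fun n => ‖f n‖) :
    ∑' x : ℤ, variationNorm r (fun N => 𝓕 (fun ξ : ℝ => Φ N ξ * (χ ξ *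
        seqFourier (twist q x f) (ξ : UnitAddCircle))) x) ^ s ≤
      ENNReal.ofReal ((C * Real.pi) ^ (s - 1) * (3 * C * Real.pi) * B ^ s) *
        (ENNReal.ofReal (1 / q) * ∑ l ∈ Finset.range q, ∫⁻ y, ‖arcPiece χ q l f y‖ₑ ^ s) := by
  have hq' : (0 : ℝ) < q := by exact_mod_cast hq
  have hpi := Real.pi_pos
  have hs0 : 0 < s := by linarith
  rw [tsum_int_eq_sum_range hq, Finset.mul_sum, Finset.mul_sum]
  refine Finset.sum_le_sum fun l _ => ?_
  have hm : ∀ N, Integrable (fun ξ : ℝ => Φ N ξ * (χ ξ *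
      seqFourier (twist q l f) (ξ : UnitAddCircle))) := by
    intro N
    have := integrable_mul_seqFourier (hΦχ N) (summable_twist q l hf)
    simpa only [mul_assoc] using this
  calc ∑' k : ℤ, variationNorm r (fun N => 𝓕 (fun ξ : ℝ => Φ N ξ * (χ ξ *
        seqFourier (twist q (k * q + l) f) (ξ : UnitAddCircle))) ((k * q + l : ℤ) : ℝ)) ^ s
      = ∑' k : ℤ, variationNorm r (fun N => 𝓕 (fun ξ : ℝ => Φ N ξ * (χ ξ *
        seqFourier (twist q l f) (ξ : UnitAddCircle))) ((l : ℝ) + q * k)) ^ s := by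
        refine tsum_congr fun k => ?_
        rw [twist_add_mul hq]
        congr 3
        ext N
        push_cast
        ring_nf
    _ ≤ ENNReal.ofReal (C * Real.pi) ^ (s - 1) * (ENNReal.ofReal (3 * C * Real.pi / q) *
        ∫⁻ y, variationNorm r (fun N => 𝓕 (fun ξ : ℝ => Φ N ξ * (χ ξ *
        seqFourier (twist q l f) (ξ : UnitAddCircle))) y) ^ s) := by
        refine tsum_variationNorm_rpow_le hr hs hC hq hS hm hχ' hc' (fun N ξ => ?_) hK l
        rw [mul_assoc, mul_right_comm (χ ξ), hχχ']
    _ ≤ ENNReal.ofReal (C * Real.pi) ^ (s - 1) * (ENNReal.ofReal (3 * C * Real.pi / q) *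
        (ENNReal.ofReal (B ^ s) * ∫⁻ y, ‖arcPiece χ q l f y‖ₑ ^ s)) := by
        gcongr
        exact hΦ.lintegral_le hs0 hB (integrable_mul_seqFourier hχ (summable_twist q l hf))
          (memLp_two_mul_seqFourier hχ2 (summable_twist q l hf)) hm
    _ = _ := by
        rw [ENNReal.ofReal_rpow_of_nonneg (by positivity) (by linarith), ← mul_assoc, ← mul_assoc,
          ← mul_assoc, ← ENNReal.ofReal_mul (by positivity), ← ENNReal.ofReal_mul (by positivity),
          ← ENNReal.ofReal_mul (by positivity)]
        congr 2
        field_simp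

theorem exists_tsum_variationNorm_arcMultiplier_le {η : ℝ → ℝ} (hη : ContDiff ℝ ∞ η)
    (hη01 : ∀ x, 0 ≤ η x ∧ η x ≤ 1) (hη_one : ∀ x, |x| ≤ 1 / 4 → η x = 1)
    (hη_zero : ∀ x, 1 / 2 ≤ |x| → η x = 0) {D : ℝ} (hD : 32 < D) {s : ℝ} (hs : 1 < s) :
    ∃ K : ℝ, 0 < K ∧ ∀ (r : ℝ), 1 ≤ r → ∀ (B : ℝ), 0 < B → ∀ (Φ : ℕ → ℝ → ℂ),
      HasVariationBound Φ r s B → ∀ (t : ℕ) (f : ℤ → ℂ), Summable (fun n => ‖f n‖) →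
      (∀ N, Integrable (fun ξ => arcMultiplier Φ η D t N ξ * seqFourier f ξ)
        AddCircle.haarAddCircle) ∧ ∀ d : ℝ, 1 ≤ d →
      (∀ q ∈ Finset.Ico (2 ^ t) (2 ^ (t + 1)), Squarefree q → (q.divisors.card : ℝ) ≤ d) →
      ∑' x : ℤ, variationNorm r (fun N =>
          fourierCoeff (fun ξ => arcMultiplier Φ η D t N ξ * seqFourier f ξ) x) ^ s ≤
        ENNReal.ofReal (K * ((d / 2 ^ t) ^ s * (2 ^ t) ^ (s - 1) *
          (d ^ s * (2 ^ t) ^ max (2 - s) 0)) * B ^ s) * ∑' n, ‖f n‖ₑ ^ s := by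
  have hs0 : 0 < s := by linarith
  have hpi := Real.pi_pos
  have hηs : ContDiff ℝ ∞ (fun x => (η x : ℂ)) := Complex.ofRealCLM.contDiff.comp hη
  have hηc : HasCompactSupport (fun x => (η x : ℂ)) := by
    refine HasCompactSupport.intro (isCompact_Icc (a := (-(1 / 2) : ℝ)) (b := 1 / 2)) fun x hx => ?_
    rw [hη_zero x, Complex.ofReal_zero]
    by_contra! h
    exact hx (abs_le.1 h.le)
  obtain ⟨C, hC, hCK⟩ := exists_isAdaptedKernel_fourier hηs hηc
  obtain ⟨E, hE, hEb⟩ := exists_sum_lintegral_rpow_arcPiece_le hs hC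
  refine ⟨(C * Real.pi) ^ (s - 1) * (3 * C * Real.pi) * E, by positivity,
    fun r hr B hB Φ hΦ t f hf => ?_⟩
  set S : ℝ := 2 * Real.pi * D ^ (t + 2) with hSdef
  set S' : ℝ := Real.pi * D ^ (t + 2) with hS'def
  have hDpow : (4 : ℝ) ^ (t + 1) ≤ D ^ (t + 2) := by
    calc (4 : ℝ) ^ (t + 1) ≤ 4 ^ (t + 2) := pow_le_pow_right₀ (by norm_num) (by omega)
      _ ≤ D ^ (t + 2) := by gcongr; linarith
  have hDpos : 0 < D ^ (t + 2) := lt_of_lt_of_le (by positivity) hDpow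
  have h4 : (1 : ℝ) ≤ 4 ^ (t + 1) := one_le_pow₀ (by norm_num)
  have hS'1 : (4 : ℝ) ^ (t + 1) ≤ S' := by
    have := Real.pi_gt_three
    rw [hS'def]; nlinarith
  have hSS' : S = 2 * S' := by rw [hSdef, hS'def]; ring
  have hS1 : (4 : ℝ) ^ (t + 1) ≤ S := by linarith
  have hS0 : 0 < S := by linarith
  have hS0' : 0 < S' := by linarith
  set χ : ℝ → ℂ := fun ξ => (cutoff η D t ξ : ℂ) with hχdef
  -- Halving the dilation makes χ' equal to 1 on |ξ| ≤ 1/(2S), which contains the support of χ.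
  set χ' : ℝ → ℂ := fun ξ => (η (S' * ξ) : ℂ) with hχ'def
  have hcomp : ∀ R : ℝ, 0 < R → ContDiff ℝ ∞ (fun ξ : ℝ => (η (R * ξ) : ℂ)) ∧
      HasCompactSupport (fun ξ : ℝ => (η (R * ξ) : ℂ)) := fun R hR =>
    ⟨hηs.comp (contDiff_const.mul contDiff_id),
      hηc.comp_homeomorph (Homeomorph.mulLeft₀ R hR.ne')⟩
  have hχs : ContDiff ℝ ∞ χ := (hcomp S hS0).1
  have hχc : HasCompactSupport χ := (hcomp S hS0).2
  have hχ's : ContDiff ℝ ∞ χ' := (hcomp S' hS0').1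
  have hχ'c : HasCompactSupport χ' := (hcomp S' hS0').2
  have hχi : Integrable χ := hχs.continuous.integrable_of_hasCompactSupport hχc
  have hχ2 : MemLp χ 2 := hχs.continuous.memLp_of_hasCompactSupport hχc
  have hχK : IsAdaptedKernel C S (𝓕 χ) := hCK S hS0
  have hχ'K : IsAdaptedKernel C S' (𝓕 χ') := hCK S' hS0'
  have hχ1 : ∀ ξ, ‖χ ξ‖ ≤ 1 := fun ξ => by
    simp only [hχdef, cutoff, Complex.norm_real, Real.norm_eq_abs, abs_of_nonneg (hη01 _).1]
    exact (hη01 _).2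
  have hsupp : ∀ ξ, 1 / (2 * S) ≤ |ξ| → χ ξ = 0 := by
    intro ξ hξ
    simp only [hχdef, cutoff]
    rw [hη_zero, Complex.ofReal_zero]
    rw [← hSdef, abs_mul, abs_of_pos hS0]
    rw [div_le_iff₀ (by positivity)] at hξ
    linarith
  have hχχ' : ∀ ξ, χ ξ * χ' ξ = χ ξ := by
    intro ξ
    by_cases h : 1 / (2 * S) ≤ |ξ|
    · rw [hsupp ξ h, zero_mul]
    · have : η (S' * ξ) = 1 := by
        refine hη_one _ ?_
        rw [abs_mul, abs_of_pos hS0']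
        rw [not_le, lt_div_iff₀ (by positivity), hSS'] at h
        linarith
      simp only [hχ'def, this, Complex.ofReal_one, mul_one]
  have hΦχ : ∀ N, Integrable fun ξ => Φ N ξ * χ ξ := by
    intro N
    -- Φ_N χ is only known to be in L²; multiplying by χ' ∈ L² changes nothing and gives
    -- integrability.
    have h := (hΦ.memLp_two hχs hχc N).integrable_mul
      (hχ's.continuous.memLp_of_hasCompactSupport (p := 2) hχ'c)
    refine h.congr (Filter.Eventually.of_forall fun ξ => ?_)
    simp only [Pi.mul_apply, mul_assoc, hχχ']
  have hk : ∀ N, ∀ x, 1 / 2 ≤ |x| → Φ N x * (cutoff η D t x : ℂ) = 0 := by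
    intro N x hx
    have : χ x = 0 := hsupp x (by
      refine le_trans ?_ hx
      rw [div_le_div_iff₀ (by positivity) (by norm_num)]
      linarith)
    rw [show (cutoff η D t x : ℂ) = χ x from rfl, this, mul_zero]
  refine ⟨fun N => integrable_arcMultiplier_mul (hk N) (hΦχ N) hf, fun d hd hdq => ?_⟩
  set Q : Finset ℕ := (Finset.Ico (2 ^ t) (2 ^ (t + 1))).filter Squarefree with hQdef
  have hQlow : ∀ q ∈ Q, ((2 : ℝ) ^ t) ≤ q := fun q hq => by
    exact_mod_cast (Finset.mem_Ico.1 (Finset.mem_filter.1 hq).1).1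
  have hQhigh : ∀ q ∈ Q, (q : ℝ) ≤ 2 ^ (t + 1) := fun q hq => by
    exact_mod_cast (Finset.mem_Ico.1 (Finset.mem_filter.1 hq).1).2.le
  have hQd : ∀ q ∈ Q, (q.divisors.card : ℝ) ≤ d := fun q hq =>
    hdq q (Finset.mem_filter.1 hq).1 (Finset.mem_filter.1 hq).2
  have hQpos : ∀ q ∈ Q, 0 < q := fun q hq => by
    have : (0 : ℝ) < q := lt_of_lt_of_le (by positivity) (hQlow q hq)
    exact_mod_cast this
  have h24 : (2 : ℝ) ^ (t + 1) ≤ 4 ^ (t + 1) := pow_le_pow_left₀ (by norm_num) (by norm_num) _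
  have hQcard : (Q.card : ℝ) ≤ 2 ^ t := by
    have h : Q.card ≤ 2 ^ t := (Finset.card_filter_le _ _).trans (by
      rw [Nat.card_Ico, pow_succ]; omega)
    exact_mod_cast h
  set W : ℕ → ℤ → ℝ≥0∞ := fun q x => variationNorm r (fun N => 𝓕 (fun ξ : ℝ => Φ N ξ * (χ ξ *
        seqFourier (twist q x f) (ξ : UnitAddCircle))) x) with hW
  have hpoint : ∀ x : ℤ, variationNorm r (fun N =>
      fourierCoeff (fun ξ => arcMultiplier Φ η D t N ξ * seqFourier f ξ) x) ^ s ≤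
      ENNReal.ofReal ((d / 2 ^ t) ^ s * (2 ^ t) ^ (s - 1)) * ∑ q ∈ Q, W q x ^ s := by
    intro x
    have h1 : variationNorm r (fun N =>
        fourierCoeff (fun ξ => arcMultiplier Φ η D t N ξ * seqFourier f ξ) x) ≤
        ENNReal.ofReal (d / 2 ^ t) * ∑ q ∈ Q, W q x := by
      have e : (fun N => fourierCoeff (fun ξ => arcMultiplier Φ η D t N ξ * seqFourier f ξ) x) =
          fun N => ∑ q ∈ Q, (ArithmeticFunction.moebius q : ℂ) / (Nat.totient q : ℂ) *
            𝓕 (fun ξ : ℝ => Φ N ξ * (χ ξ * seqFourier (twist q x f) (ξ : UnitAddCircle))) x := by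
        ext N
        rw [fourierCoeff_arcMultiplier_mul (hk N) (hΦχ N) hf, hQdef, Finset.sum_filter]
        refine Finset.sum_congr rfl fun q _ => ?_
        split_ifs with h
        · rfl
        · rw [ArithmeticFunction.moebius_eq_zero_of_not_squarefree h]
          simp
      rw [e, Finset.mul_sum]
      refine (variationNorm_sum_le hr Q _ _).trans (Finset.sum_le_sum fun q hq => ?_)
      refine mul_le_mul_left ?_ _
      rw [← ofReal_norm]
      exact ENNReal.ofReal_le_ofReal
        (norm_moebius_div_totient_le (by positivity) (hQlow q hq) (hQd q hq))
    calc _ ≤ (ENNReal.ofReal (d / 2 ^ t) * ∑ q ∈ Q, W q x) ^ s := ENNReal.rpow_le_rpow h1 hs0.le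
      _ = ENNReal.ofReal ((d / 2 ^ t) ^ s) * (∑ q ∈ Q, W q x) ^ s := by
          rw [ENNReal.mul_rpow_of_nonneg _ _ hs0.le,
            ENNReal.ofReal_rpow_of_nonneg (by positivity) hs0.le]
      _ ≤ ENNReal.ofReal ((d / 2 ^ t) ^ s) * ((Q.card : ℝ≥0∞) ^ (s - 1) * ∑ q ∈ Q, W q x ^ s) := by
          gcongr
          -- Hölder over the denominators: the loss (2^t)^(s-1) is one power of 2^t short of the
          -- gain 2^(-ts) from 1/φ(q).
          exact ENNReal.rpow_sum_le_const_mul_sum_rpow _ _ hs.le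
      _ ≤ ENNReal.ofReal ((d / 2 ^ t) ^ s) *
            (ENNReal.ofReal ((2 ^ t) ^ (s - 1)) * ∑ q ∈ Q, W q x ^ s) := by
          refine mul_le_mul_right (mul_le_mul_left ?_ _) _
          rw [← ENNReal.ofReal_rpow_of_nonneg (by positivity) (by linarith)]
          refine ENNReal.rpow_le_rpow ?_ (by linarith)
          rw [← ENNReal.ofReal_natCast]
          exact ENNReal.ofReal_le_ofReal hQcard
      _ = _ := by rw [← mul_assoc, ← ENNReal.ofReal_mul (by positivity)]
  have hprog : ∀ q ∈ Q, ∑' x : ℤ, W q x ^ s ≤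
      ENNReal.ofReal ((C * Real.pi) ^ (s - 1) * (3 * C * Real.pi) * B ^ s) *
        (ENNReal.ofReal (1 / q) * ∑ l ∈ Finset.range q, ∫⁻ y, ‖arcPiece χ q l f y‖ₑ ^ s) :=
    fun q hq => tsum_variationNorm_progression_le hr hs hB hΦ hC.le (hQpos q hq)
      (by linarith [hQhigh q hq]) hχi hχ2 hΦχ hχ's hχ'c hχχ' hχ'K hf
  -- With arc radius κ = 1/(2S), the separation condition is q q' ≤ S, which follows from q q' ≤
  -- 4^(t+1) ≤ S.
  have hop := hEb χ S (1 / (2 * S)) d (2 ^ t) Q hχi hχ2 hχ1 hsupp hχK (by positivity) hd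
    (one_le_pow₀ (by norm_num)) hQcard
    (fun q hq => ⟨hQpos q hq, by linarith [hQhigh q hq], hQd q hq⟩)
    (fun q hq q' hq' => by
      have h1 := hQhigh q hq
      have h2 := hQhigh q' hq'
      have h3 : (q : ℝ) * q' ≤ 4 ^ (t + 1) := by
        calc (q : ℝ) * q' ≤ 2 ^ (t + 1) * 2 ^ (t + 1) := by gcongr
          _ = 4 ^ (t + 1) := by rw [← mul_pow]; norm_num
      rw [show 2 * (1 / (2 * S)) = 1 / S by field_simp, one_div, inv_mul_le_iff₀ hS0]
      linarith) f hf
  calc _ ≤ ∑' x : ℤ, ENNReal.ofReal ((d / 2 ^ t) ^ s * (2 ^ t) ^ (s - 1)) * ∑ q ∈ Q, W q x ^ s :=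
        ENNReal.tsum_le_tsum hpoint
    _ = ENNReal.ofReal ((d / 2 ^ t) ^ s * (2 ^ t) ^ (s - 1)) * ∑ q ∈ Q, ∑' x : ℤ, W q x ^ s := by
        rw [ENNReal.tsum_mul_left, Summable.tsum_finsetSum (fun _ _ => ENNReal.summable)]
    _ ≤ ENNReal.ofReal ((d / 2 ^ t) ^ s * (2 ^ t) ^ (s - 1)) *
          ∑ q ∈ Q, ENNReal.ofReal ((C * Real.pi) ^ (s - 1) * (3 * C * Real.pi) * B ^ s) *
        (ENNReal.ofReal (1 / q) * ∑ l ∈ Finset.range q, ∫⁻ y, ‖arcPiece χ q l f y‖ₑ ^ s) := by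
        gcongr with q hq
        exact hprog q hq
    _ ≤ ENNReal.ofReal ((d / 2 ^ t) ^ s * (2 ^ t) ^ (s - 1)) *
          (ENNReal.ofReal ((C * Real.pi) ^ (s - 1) * (3 * C * Real.pi) * B ^ s) *
          (ENNReal.ofReal (E * (d ^ s * (2 ^ t) ^ max (2 - s) 0)) * ∑' n, ‖f n‖ₑ ^ s)) := by
        rw [← Finset.mul_sum]
        gcongr
    _ = _ := by
        rw [← mul_assoc, ← mul_assoc, ← ENNReal.ofReal_mul (by positivity),
          ← ENNReal.ofReal_mul (by positivity)]
        congr 2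
        ring

/-- Put m = min 1 (s - 1), so max(2 - s, 0) = 1 - m. The exponent of 2^t is 2sε - s + (s - 1) + (1 -
m) = -m/2, as 2sε = m/2; the shift t + 1 in the divisor bound leaves the factor 2^(m/2). -/
theorem two_pow_exponent_bound {s a ε : ℝ} (hs : 1 < s) (ha : 1 ≤ a)
    (hε : ε = min 1 (s - 1) / (4 * s)) (t : ℕ) :
    (a * (2 ^ (t + 1) : ℝ) ^ ε / 2 ^ t) ^ s * ((2 : ℝ) ^ t) ^ (s - 1) *
        ((a * (2 ^ (t + 1) : ℝ) ^ ε) ^ s * ((2 : ℝ) ^ t) ^ max (2 - s) 0) =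
      a ^ (2 * s) * 2 ^ (min 1 (s - 1) / 2) * ((2 : ℝ) ^ (-((t : ℝ) * (min 1 (s - 1) / (2 * s))))) ^ s := by
  have hs0 : 0 < s := by linarith
  have ha0 : 0 < a := by linarith
  set m := min 1 (s - 1) with hm
  have hmax : max (2 - s) 0 = 1 - m := by
    rcases le_total (s - 1) 1 with h | h
    · rw [hm, min_eq_right h, max_eq_left (by linarith)]; ring
    · rw [hm, min_eq_left h, max_eq_right (by linarith)]; ring
  have e1 : (2 ^ (t + 1) : ℝ) = 2 ^ ((t : ℝ) + 1) := by
    rw [← Real.rpow_natCast]; push_cast; rfl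
  have e2 : (2 ^ t : ℝ) = 2 ^ (t : ℝ) := (Real.rpow_natCast _ _).symm
  rw [hmax, e1, e2, Real.div_rpow (by positivity) (by positivity),
    Real.mul_rpow (by positivity) (by positivity), div_eq_mul_inv,
    ← Real.rpow_neg (by positivity)]
  simp only [← Real.rpow_mul (show (0 : ℝ) ≤ 2 by norm_num)]
  rw [show a ^ (2 * s) = a ^ s * a ^ s by rw [← Real.rpow_add ha0]; ring_nf]
  have e3 : (2 : ℝ) ^ (((t : ℝ) + 1) * ε * s) * 2 ^ ((t : ℝ) * -s) * 2 ^ ((t : ℝ) * (s - 1)) *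
      (2 ^ (((t : ℝ) + 1) * ε * s) * 2 ^ ((t : ℝ) * (1 - m))) =
      2 ^ (m / 2) * 2 ^ (-((t : ℝ) * (m / (2 * s))) * s) := by
    simp only [← Real.rpow_add (show (0 : ℝ) < 2 by norm_num)]
    congr 1
    rw [hε]
    field_simp
    ring
  linear_combination (a ^ s * a ^ s) * e3

theorem mainTheorem3
    (η : ℝ → ℝ) (hη : ContDiff ℝ ∞ η) (hη01 : ∀ x, 0 ≤ η x ∧ η x ≤ 1)
    (hη_one : ∀ x, |x| ≤ 1 / 4 → η x = 1) (hη_zero : ∀ x, 1 / 2 ≤ |x| → η x = 0)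
    (D : ℝ) (hD : 32 < D) (s : ℝ) (hs : 1 < s) :
    ∃ C : ℝ, 0 < C ∧ ∃ δ : ℝ, 0 < δ ∧
      ∀ (r : ℝ), 1 ≤ r → ∀ (B : ℝ), 0 < B → ∀ (Φ : ℕ → ℝ → ℂ), HasVariationBound Φ r s B →
        ∀ (t : ℕ) (f : ℤ → ℂ), Summable (fun n => ‖f n‖) →
          (∀ N, Integrable (fun ξ => arcMultiplier Φ η D t N ξ * seqFourier f ξ)
            AddCircle.haarAddCircle) ∧
          eLpNorm (fun x : ℤ => variationNorm r (fun N =>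
              fourierCoeff (fun ξ => arcMultiplier Φ η D t N ξ * seqFourier f ξ) x))
            (ENNReal.ofReal s) Measure.count
          ≤ ENNReal.ofReal (C * B * (2 : ℝ) ^ (-((t : ℝ) * δ))) *
              eLpNorm f (ENNReal.ofReal s) Measure.count := by
  have hs0 : 0 < s := by linarith
  have hm0 : 0 < min 1 (s - 1) := lt_min one_pos (by linarith)
  obtain ⟨K, hK, hKb⟩ :=
    exists_tsum_variationNorm_arcMultiplier_le hη hη01 hη_one hη_zero hD hs
  obtain ⟨a, ha, hab⟩ := exists_card_divisors_le (ε := min 1 (s - 1) / (4 * s)) (by positivity)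
  -- These are the s-th roots of the constant and of the decay 2^(-tm/2), m = min 1 (s - 1), so δ =
  -- m/(2s).
  refine ⟨(K * (a ^ (2 * s) * 2 ^ (min 1 (s - 1) / 2))) ^ (1 / s), by positivity,
    min 1 (s - 1) / (2 * s), by positivity, fun r hr B hB Φ hΦ t f hf => ?_⟩
  obtain ⟨hint, hbound⟩ := hKb r hr B hB Φ hΦ t f hf
  refine ⟨hint, ?_⟩
  have hb := hbound (a * (2 ^ (t + 1) : ℝ) ^ (min 1 (s - 1) / (4 * s)))
    (one_le_mul_of_one_le_of_one_le ha
      (Real.one_le_rpow (one_le_pow₀ (by norm_num)) (by positivity)))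
    (fun q hq hsq => (hab q hsq).trans (by
      have : (q : ℝ) ≤ 2 ^ (t + 1) := by exact_mod_cast (Finset.mem_Ico.1 hq).2.le
      gcongr))
  rw [two_pow_exponent_bound hs ha rfl] at hb
  refine (ENNReal.rpow_le_rpow_iff hs0).1 ?_
  rw [ENNReal.mul_rpow_of_nonneg _ _ hs0.le, eLpNorm_ofReal_rpow _ hs0, eLpNorm_ofReal_rpow _ hs0,
    lintegral_count, lintegral_count, ENNReal.ofReal_rpow_of_nonneg (by positivity) hs0.le]
  simp only [enorm_eq_self]
  refine hb.trans (le_of_eq ?_)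
  congr 2
  rw [Real.mul_rpow (by positivity) (by positivity), Real.mul_rpow (by positivity) hB.le,
    ← Real.rpow_mul (x := K * _) (by positivity), one_div_mul_cancel hs0.ne', Real.rpow_one]
  ring
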